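/- **Problem.** Let $E,I,V$ be finite index sets and let $f,h_i\,(i\in E),g_i\,(i\in I),G_i,H_i\,(i\in V):\mathbb R^n\to\mathbb R$ be continuously differentiable. The mathematical program with vanishing constraints (MPVC) is $$\min_x f(x)\ \text{ s.t. } h_i(x)=0\,(i\in E),\quad g_i(x)\le 0\,(i\in I),\quad H_i(x)\ge 0,\ G_i(x)H_i(x)\le 0\,(i\in V).$$ A feasible $\bar x$ is *M-stationary* if there are multipliers $\lambda^h,\lambda^g,\lambda^H,\lambda^G$ with $$\nabla f(\bar x)+\sum_{i\in E}\lambda^h_i\nabla h_i(\bar x)+\sum_{i\in I}\lambda_i^g\nabla g_i(\bar x)+\sum_{i\in V}\bigl(-\lambda_i^H\nabla H_i(\bar x)+\lambda_i^G\nabla G_i(\bar x)\bigr)=0,$$ $\lambda^g_ig_i(\bar x)=0\le\lambda_i^g$ for $i\in I$, $\lambda_i^HH_i(\bar x)=\lambda_i^GG_i(\bar x)=0$ for $i\in V$, $\lambda_i^H\ge0$ if $H_i(\bar x)=0>G_i(\bar x)$, $\lambda_i^G\ge 0$ if $G_i(\bar x)=0\le H_i(\bar x)$, and $\lambda_i^H\lambda_i^G=0$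 if $H_i(\bar x)=G_i(\bar x)=0$. **Auxiliary problem.** Put $P^1=\{0\}\times\mathbb R$, $P^2=\mathbb R_-^2$, $P=P^1\cup P^2$, $F_i=(-H_i,G_i)$, $d(u,A)=\inf_{v\in A}\|u-v\|_1$. Fix $x$, a symmetric positive definite matrix $B$ and $\rho>0$; write $f,\nabla f,h_i,\nabla h_i,\dots$ for values and gradients at $x$. Let $\theta^g_i=1$ if $g_i>0$ and $0$ otherwise; let $(\theta_i^H,\theta_i^G)=(0,0)$ if $d(F_i,P)=0$, $(1,0)$ if $0<d(F_i,P^1)\le d(F_i,P^2)$, and $(0,1)$ if $0<d(F_i,P^2)<d(F_i,P^1)$. Let $\tilde F_i(s,\delta)=\delta(\theta_i^HH_i,-\theta_i^GG_i)+F_i+\nabla F_is$. For $V_1\subset V$ let $QP(\rho,V_1)$ be the problem of minimizing $\frac12s^TBs+\nabla f s+\rho(\frac12\delta^2+\delta)$ over $(s,\delta)\in\mathbb R^{n+1}$ subject to $(1-\delta)h_i+\nabla h_is=0$, $(1-\theta_i^g\delta)g_i+\nabla g_is\le0$, $\tilde F_i(s,\delta)\in P^1$ $(i\in V_1)$, $\tilde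 F_i(s,\delta)\in P^2$ $(i\in V\setminus V_1)$, $\delta\ge0$. A multiplier of $QP(\rho,V_1)$ at a solution is a $\lambda=(\lambda^h,\lambda^g,\lambda^H,\lambda^G)$ for which the KKT conditions of this convex problem hold (with $(\lambda_i^H,\lambda_i^G)$ in the normal cone of $P^1$, resp. $P^2$, at $\tilde F_i(s,\delta)$, and some multiplier $\lambda^\delta\ge 0$ of $\delta\ge0$). Let $\bar\delta(V_1)$ be the least $\delta$ over the feasible set of $QP(\rho,V_1)$, and let $I^1(s,\delta)=\{i:\tilde F_i(s,\delta)\in P^1\setminus P^2\}$, $I^{00}(s,\delta)=\{i:\tilde F_i(s,\delta)=0\}$. **Auxiliary solver** (given $\zeta\in(0,1)$, $\bar\rho>1$, $\rho>0$). (1) Set $(s^0,\delta^0)=(0,1)$, $V_1^1=I^1(s^0,\delta^0)$, let $(s^1,\delta^1)$ be the solution and $\lambda^1$ a multiplier of $QP(\rho,V_1^1)$, $t=1$; if $\delta^1>\delta^0$, restart. (2) While $(s^t,\delta^t)$ does not solve all four problems $QP(\rho,W)$ with, in this order, $W=I^1\cup(I^{00}\cap V_1^t)$, $I^1\cup(I^{00}\setminus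 V_1^t)$, $I^1$, $I^1\cup I^{00}$ (index sets at $(s^t,\delta^t)$): take the first $W$ whose solution differs from $(s^t,\delta^t)$, let $(s^{t+1},\delta^{t+1})$ be this solution, $\lambda^{t+1}$ a multiplier, $V_1^{t+1}=W$, increase $t$ by one, and restart if $\delta^t>\delta^{t-1}$. (3) If $\delta^t<\zeta$, stop successfully with $N=t$. (4) Otherwise, restart if $\min\{\bar\delta(I^1),\bar\delta(I^1\cup I^{00})\}<\zeta$, else stop because of degeneracy. A restart replaces $\rho$ by $\rho\bar\rho$ and goes to (1). After a successful stop, $\underline\lambda^{N}$ denotes a multiplier of $QP(\rho,I^1\cup I^{00})$ at $(s^N,\delta^N)$, with index sets at that point (an M-stationary multiplier of the auxiliary problem). **Basic SQP method.** Constants: $\zeta\in(0,1)$, $\bar\rho>1$, $1<\xi_1<\xi_2$, $\xi\in(0,1)$, $0<\underline\gamma\le\bar\gamma<1$. Start with $x_0$, $\rho_0>0$, positive definite $B_0$ and positive penalties $\sigma_{-1}=(\sigma^h_{-1},\sigma^g_{-1},\sigma^F_{-1})$. In iteration $k$, run the solver at $x_k$ with $B_k$ and $\rho=\rho_k$; stop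 if it stops because of degeneracy or if $s_k^{N_k}=0$. Let $\rho_{k+1}$ be the final $\rho$ of the solver. With $\tilde\lambda_{i,k}^h=\max_{1\le t\le N_k}|\lambda_{i,k}^{h,t}|$, $\tilde\lambda_{i,k}^g=\max_t|\lambda_{i,k}^{g,t}|$, $\tilde\lambda^F_{i,k}=\max_t\|(\lambda^{H,t}_{i,k},\lambda^{G,t}_{i,k})\|_\infty$, each penalty is updated to $\sigma_{i,k}=\xi_2\tilde\lambda_{i,k}$ if $\sigma_{i,k-1}<\xi_1\tilde\lambda_{i,k}$, and $\sigma_{i,k}=\sigma_{i,k-1}$ otherwise. Let $S_k^t=\sum_{\tau=1}^t\|s_k^\tau-s_k^{\tau-1}\|$. For $\alpha\in[0,1]$ and $s=(1-\alpha)s_k^{t-1}+\alpha s_k^t$ put $$\phi_k^t(\alpha)=f(x_k+s)+\sum_{i\in E}\sigma_{i,k}^h|h_i(x_k+s)|+\sum_{i\in I}\sigma_{i,k}^g(g_i(x_k+s))^++\sum_{i\in V}\sigma_{i,k}^Fd(F_i(x_k+s),P^{(i)}),$$ where $P^{(i)}=P^1$ if $i\in V_{1,k}^t$ and $P^{(i)}=P^2$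 otherwise, and let $\hat\phi_k^t(\alpha)$ be the same expression with $f(x_k+s)$ replaced by $f(x_k)+\nabla f(x_k)s+\frac12s^TB_ks$ and the constraint functions replaced by their linearizations at $x_k$. Set $t_k(1)=N_k$, $\alpha_k(1)=1$, and for $\gamma\in[0,1)$ let $t_k(\gamma)$ be the smallest $t$ with $S_k^t>\gamma S_k^{N_k}$ and $\alpha_k(\gamma)=(\gamma S_k^{N_k}-S_k^{t_k(\gamma)-1})/(S_k^{t_k(\gamma)}-S_k^{t_k(\gamma)-1})$. With $t=t_k(\gamma)$ and $\alpha=\alpha_k(\gamma)$ let $\hat s_k(\gamma)=(1-\alpha)s_k^{t-1}+\alpha s_k^t$, $Y_k(\gamma)=\phi_k^t(\alpha)$, $Z_k(\gamma)=(1-\alpha)\hat\phi_k^t(0)+\alpha\hat\phi_k^t(1)$. Given positive numbers $\gamma^k_1=1,\gamma_2^k,\dots$ with $\underline\gamma\le\gamma_{j+1}^k/\gamma_j^k\le\bar\gamma$, let $j(k)$ be the smallest $j$ with $Y_k(\gamma_j^k)-Y_k(0)\le\xi(Z_k(\gamma_j^k)-Z_k(0))$, and set $x_{k+1}=x_k+\hat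 s_k(\gamma^k_{j(k)})$. Choose any positive definite $B_{k+1}$ and continue. **Theorem.** Suppose the method never stops, so that it generates infinite sequences, and assume: 1. $\|x_k\|$, $S_k^{N_k}$, all $\tilde\lambda^h_{i,k},\tilde\lambda^g_{i,k},\tilde\lambda^F_{i,k}$, and the multipliers $\underline\lambda_k^{N_k}$ are bounded uniformly in $k$; 2. there are constants $0<\underline C_B\le\bar C_B$ such that for all $k$ the smallest eigenvalue of $B_k$ is at least $\underline C_B$ and $\|B_k\|\le\bar C_B$. Then every limit point of $(x_k)$ is M-stationary for the MPVC; in particular it is feasible. -/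

import Mathlib

noncomputable section

namespace VanishingConstraints

/-- Euclidean space `ℝⁿ` with the `ℓ²` norm. -/
abbrev Vec (n : ℕ) := EuclideanSpace ℝ (Fin n)

/-- A mathematical program with vanishing constraints:
minimize `f x` subject to `h i x = 0`, `g i x ≤ 0`, `H i x ≥ 0`, `G i x * H i x ≤ 0`,
with continuously differentiable data. -/
structure MPVC (n : ℕ) (E I V : Type*) where
  f : Vec n → ℝ
  h : E → Vec n → ℝ
  g : I → Vec n → ℝ
  G : V → Vec n → ℝ
  H : V → Vec n → ℝ
  contDiff_f : ContDiff ℝ 1 f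
  contDiff_h : ∀ i, ContDiff ℝ 1 (h i)
  contDiff_g : ∀ i, ContDiff ℝ 1 (g i)
  contDiff_G : ∀ i, ContDiff ℝ 1 (G i)
  contDiff_H : ∀ i, ContDiff ℝ 1 (H i)

/-- Multipliers `(λ^h, λ^g, λ^H, λ^G)`. -/
structure Multiplier (E I V : Type*) where
  h : E → ℝ
  g : I → ℝ
  H : V → ℝ
  G : V → ℝ

namespace MPVC

variable {n : ℕ} {E I V : Type*}

def IsFeasible (P : MPVC n E I V) (x : Vec n) : Prop :=
  (∀ i, P.h i x = 0) ∧ (∀ i, P.g i x ≤ 0) ∧ (∀ i, 0 ≤ P.H i x ∧ P.G i x * P.H i x ≤ 0)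

/-- The index set `I^{0-}(x)`. -/
def I0neg (P : MPVC n E I V) (x : Vec n) : Set V := {i | P.H i x = 0 ∧ P.G i x < 0}

/-- The index set `I^{+0}(x)`. -/
def Ipos0 (P : MPVC n E I V) (x : Vec n) : Set V := {i | 0 < P.H i x ∧ P.G i x = 0}

/-- The index set `I^{00}(x)`. -/
def I00 (P : MPVC n E I V) (x : Vec n) : Set V := {i | P.H i x = 0 ∧ P.G i x = 0}

/-- Conditions on a multiplier for weak stationarity of `x`. -/
structure IsWeakMultiplier [Fintype E] [Fintype I] [Fintype V]
    (P : MPVC n E I V) (x : Vec n) (l : Multiplier E I V) : Prop where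
  stationarity :
    gradient P.f x + ∑ i, l.h i • gradient (P.h i) x + ∑ i, l.g i • gradient (P.g i) x
      + ∑ i, (-(l.H i • gradient (P.H i) x) + l.G i • gradient (P.G i) x) = 0
  compl_g : ∀ i, l.g i * P.g i x = 0
  compl_H : ∀ i, l.H i * P.H i x = 0
  compl_G : ∀ i, l.G i * P.G i x = 0
  nonneg_g : ∀ i, 0 ≤ l.g i
  nonneg_H : ∀ i ∈ P.I0neg x, 0 ≤ l.H i
  nonneg_G : ∀ i ∈ P.I00 x ∪ P.Ipos0 x, 0 ≤ l.G i

/-- M-stationarity. -/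
def IsMStationary [Fintype E] [Fintype I] [Fintype V] (P : MPVC n E I V) (x : Vec n) : Prop :=
  P.IsFeasible x ∧ ∃ l : Multiplier E I V, P.IsWeakMultiplier x l ∧
    ∀ i ∈ P.I00 x, l.H i * l.G i = 0

end MPVC

/-- `P = {(a,b) | a ≤ 0, ab ≥ 0}`. -/
def setP : Set (ℝ × ℝ) := {u | u.1 ≤ 0 ∧ 0 ≤ u.1 * u.2}

/-- `P¹ = {0} × ℝ`. -/
def setP1 : Set (ℝ × ℝ) := {u | u.1 = 0}

/-- `P² = ℝ₋ × ℝ₋`. -/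
def setP2 : Set (ℝ × ℝ) := {u | u.1 ≤ 0 ∧ u.2 ≤ 0}

/-- The `ℓ¹` distance of a point of the plane to a set. -/
def dist1 (u : ℝ × ℝ) (A : Set (ℝ × ℝ)) : ℝ := ⨅ v : A, (|u.1 - v.1.1| + |u.2 - v.1.2|)

/-- The normal cone of convex analysis to a subset `A` of the plane at `u`. -/
def normalCone (A : Set (ℝ × ℝ)) (u : ℝ × ℝ) : Set (ℝ × ℝ) :=
  {z | u ∈ A ∧ ∀ v ∈ A, z.1 * (v.1 - u.1) + z.2 * (v.2 - u.2) ≤ 0}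

/-- The data of an auxiliary problem: a matrix `B`, and numbers and (row) vectors that stand for
values and gradients of the problem functions at one point. -/
structure AuxData (n : ℕ) (E I V : Type*) where
  B : Matrix (Fin n) (Fin n) ℝ
  df : Vec n
  h : E → ℝ
  dh : E → Vec n
  g : I → ℝ
  dg : I → Vec n
  G : V → ℝ
  dG : V → Vec n
  H : V → ℝ
  dH : V → Vec n

/-- The data of the auxiliary problem at the point `x` with the matrix `B`. -/
def MPVC.auxData {n : ℕ} {E I V : Type*} (P : MPVC n E I V) (B : Matrix (Fin n) (Fin n) ℝ)
    (x : Vec n) : AuxData n E I V where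
  B := B
  df := gradient P.f x
  h i := P.h i x
  dh i := gradient (P.h i) x
  g i := P.g i x
  dg i := gradient (P.g i) x
  G i := P.G i x
  dG i := gradient (P.G i) x
  H i := P.H i x
  dH i := gradient (P.H i) x

/-- What one pass of the auxiliary solver records: the number `N` of pieces, the points
`(s^t, δ^t)` for `0 ≤ t ≤ N`, and the multipliers `λ^t` and index sets `V_1^t` for `1 ≤ t ≤ N`.
Values at other `t` are irrelevant. -/
structure Pass (n : ℕ) (E I V : Type*) where
  N : ℕ
  s : ℕ → Vec n
  δ : ℕ → ℝ
  lam : ℕ → Multiplier E I V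
  V1 : ℕ → Set V

namespace AuxData

variable {n : ℕ} {E I V : Type*}

/-- The matrix `B` as an operator on `ℝⁿ`. -/
def opB (q : AuxData n E I V) : Vec n →L[ℝ] Vec n := Matrix.toEuclideanCLM (𝕜 := ℝ) q.B

/-- `F_i = (-H_i, G_i)`. -/
def F (q : AuxData n E I V) (i : V) : ℝ × ℝ := (-q.H i, q.G i)

/-- `∇F_i s`. -/
def dF (q : AuxData n E I V) (i : V) (s : Vec n) : ℝ × ℝ := (-inner ℝ (q.dH i) s, inner ℝ (q.dG i) s)

open Classical in
/-- `θ_i^g`. -/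
def thetag (q : AuxData n E I V) (i : I) : ℝ := if 0 < q.g i then 1 else 0

open Classical in
/-- The pair `(θ_i^H, θ_i^G)`. -/
def thetaHG (q : AuxData n E I V) (i : V) : ℝ × ℝ :=
  if dist1 (q.F i) setP = 0 then (0, 0)
  else if dist1 (q.F i) setP1 ≤ dist1 (q.F i) setP2 then (1, 0)
  else (0, 1)

/-- The vector `(θ_i^H H_i, -θ_i^G G_i)`. -/
def relax (q : AuxData n E I V) (i : V) : ℝ × ℝ :=
  ((q.thetaHG i).1 * q.H i, -((q.thetaHG i).2 * q.G i))

/-- `δ (θ_i^H H_i, -θ_i^G G_i) + F_i + ∇F_i s` for `z = (s, δ)`. -/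
def relaxedF (q : AuxData n E I V) (z : Vec n × ℝ) (i : V) : ℝ × ℝ :=
  z.2 • q.relax i + q.F i + q.dF i z.1

/-- The index set `I¹(s, δ)`. -/
def I1 (q : AuxData n E I V) (z : Vec n × ℝ) : Set V := {i | q.relaxedF z i ∈ setP1 \ setP2}

/-- The index set `I^{00}(s, δ)`. -/
def I00 (q : AuxData n E I V) (z : Vec n × ℝ) : Set V := {i | q.relaxedF z i = (0, 0)}

/-- The objective of the quadratic programs. -/
def objective (q : AuxData n E I V) (ρ : ℝ) (z : Vec n × ℝ) : ℝ :=
  (1 / 2) * inner ℝ z.1 (q.opB z.1) + inner ℝ q.df z.1 + ρ * ((1 / 2) * z.2 ^ 2 + z.2)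

/-- Feasibility of `z = (s, δ)` for the convex piece `QP(ρ, V1)`, where `V_2 = V \ V_1`. -/
structure IsFeasible (q : AuxData n E I V) (V1 : Set V) (z : Vec n × ℝ) : Prop where
  eq_h : ∀ i, (1 - z.2) * q.h i + inner ℝ (q.dh i) z.1 = 0
  le_g : ∀ i, (1 - q.thetag i * z.2) * q.g i + inner ℝ (q.dg i) z.1 ≤ 0
  mem_P1 : ∀ i ∈ V1, q.relaxedF z i ∈ setP1
  mem_P2 : ∀ i ∉ V1, q.relaxedF z i ∈ setP2
  nonneg : 0 ≤ z.2

/-- `z = (s, δ)` is a solution (global minimizer) of `QP(ρ, V1)`. -/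
def IsSolution (q : AuxData n E I V) (ρ : ℝ) (V1 : Set V) (z : Vec n × ℝ) : Prop :=
  q.IsFeasible V1 z ∧ ∀ w, q.IsFeasible V1 w → q.objective ρ z ≤ q.objective ρ w

/-- `l` is a multiplier (satisfies the KKT conditions) for `QP(ρ, V1)` at `z = (s, δ)`. -/
def IsKKT [Fintype E] [Fintype I] [Fintype V] (q : AuxData n E I V) (ρ : ℝ) (V1 : Set V)
    (z : Vec n × ℝ) (l : Multiplier E I V) : Prop :=
  (q.opB z.1 + q.df + ∑ i, l.h i • q.dh i + ∑ i, l.g i • q.dg i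
      + ∑ i, (-(l.H i • q.dH i) + l.G i • q.dG i) = 0) ∧
  (∃ lδ : ℝ, 0 ≤ lδ ∧ lδ * z.2 = 0 ∧
    ρ * (z.2 + 1) - lδ - ∑ i, l.h i * q.h i - ∑ i, l.g i * q.thetag i * q.g i
      + ∑ i, ((q.relax i).1 * l.H i + (q.relax i).2 * l.G i) = 0) ∧
  (∀ i, l.g i * ((1 - q.thetag i * z.2) * q.g i + inner ℝ (q.dg i) z.1) = 0 ∧ 0 ≤ l.g i) ∧
  (∀ i ∈ V1, (l.H i, l.G i) ∈ normalCone setP1 (q.relaxedF z i)) ∧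
  (∀ i ∉ V1, (l.H i, l.G i) ∈ normalCone setP2 (q.relaxedF z i))

/-- The smallest `δ` over the feasible set of the piece given by `V1`. -/
def deltaBar (q : AuxData n E I V) (V1 : Set V) : ℝ :=
  sInf {δ | ∃ s, q.IsFeasible V1 (s, δ)}

/-- The four pieces, in order, that are tested at the point `z` reached with the index set `V1`. -/
def testPieces (q : AuxData n E I V) (z : Vec n × ℝ) (V1 : Set V) : Fin 4 → Set V :=
  ![q.I1 z ∪ (q.I00 z ∩ V1), q.I1 z ∪ (q.I00 z \ V1), q.I1 z, q.I1 z ∪ q.I00 z]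

end AuxData

namespace Pass

variable {n : ℕ} {E I V : Type*}

/-- The point `(s^t, δ^t)`. -/
def pt (r : Pass n E I V) (t : ℕ) : Vec n × ℝ := (r.s t, r.δ t)

/-- `r` records a pass of the auxiliary solver with fixed `ρ`, from the initialization until the
counter of pieces has reached `N`, with no restart triggered before that. -/
structure IsPass [Fintype E] [Fintype I] [Fintype V] (r : Pass n E I V) (q : AuxData n E I V)
    (ρ : ℝ) : Prop where
  one_le : 1 ≤ r.N
  s_zero : r.s 0 = 0
  δ_zero : r.δ 0 = 1
  V1_one : r.V1 1 = q.I1 (r.pt 0)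
  solution : ∀ t, 1 ≤ t → t ≤ r.N → q.IsSolution ρ (r.V1 t) (r.pt t)
  multiplier : ∀ t, 1 ≤ t → t ≤ r.N → q.IsKKT ρ (r.V1 t) (r.pt t) (r.lam t)
  /-- The next piece is the first of the four test pieces whose solution differs from the
  current point. -/
  next_piece : ∀ t, 1 ≤ t → t < r.N → ∃ j : Fin 4,
    r.V1 (t + 1) = q.testPieces (r.pt t) (r.V1 t) j ∧ r.pt (t + 1) ≠ r.pt t ∧
    ∀ j' < j, q.IsSolution ρ (q.testPieces (r.pt t) (r.V1 t) j') (r.pt t)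
  no_restart : ∀ t, 1 ≤ t → t < r.N → r.δ t ≤ r.δ (t - 1)

/-- The improvement loop is left at the final point: `δ` did not increase and the final point
solves all four test pieces. -/
def ExitsLoop (r : Pass n E I V) (q : AuxData n E I V) (ρ : ℝ) : Prop :=
  r.δ r.N ≤ r.δ (r.N - 1) ∧
    ∀ j, q.IsSolution ρ (q.testPieces (r.pt r.N) (r.V1 r.N) j) (r.pt r.N)

/-- The pass terminates successfully. -/
def Succeeds (r : Pass n E I V) (q : AuxData n E I V) (ρ ζ : ℝ) : Prop :=
  r.ExitsLoop q ρ ∧ r.δ r.N < ζ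

/-- The pass ends with a restart, either because `δ` has increased or because the loop is left
with `δ ≥ ζ` while the non-degeneracy condition holds. -/
def Restarts (r : Pass n E I V) (q : AuxData n E I V) (ρ ζ : ℝ) : Prop :=
  r.δ (r.N - 1) < r.δ r.N ∨
    (r.ExitsLoop q ρ ∧ ζ ≤ r.δ r.N ∧
      min (q.deltaBar (q.I1 (r.pt r.N))) (q.deltaBar (q.I1 (r.pt r.N) ∪ q.I00 (r.pt r.N))) < ζ)

/-- The auxiliary solver, started with `ρ`, terminates successfully (not because of degeneracy)
with final penalty `ρ'`, and `r` records its last pass. Each restart multiplies the penalty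
by `ρbar`. -/
def IsSolverOutcome [Fintype E] [Fintype I] [Fintype V] (r : Pass n E I V) (q : AuxData n E I V)
    (ζ ρbar ρ ρ' : ℝ) : Prop :=
  ∃ m : ℕ, ρ' = ρ * ρbar ^ m ∧
    (∀ j < m, ∃ r' : Pass n E I V,
      r'.IsPass q (ρ * ρbar ^ j) ∧ r'.Restarts q (ρ * ρbar ^ j) ζ) ∧
    r.IsPass q ρ' ∧ r.Succeeds q ρ' ζ

/-- The length `S^t` of the polygonal line through `s^0, …, s^t`. -/
def len (r : Pass n E I V) (t : ℕ) : ℝ := ∑ τ ∈ Finset.Icc 1 t, ‖r.s τ - r.s (τ - 1)‖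

/-- `λ̃_i^h`, the maximum of `|λ_i^{h,t}|` over `1 ≤ t ≤ N`. -/
def maxH (r : Pass n E I V) (i : E) : ℝ := sSup ((fun t => |(r.lam t).h i|) '' Set.Icc 1 r.N)

/-- `λ̃_i^g`, the maximum of `|λ_i^{g,t}|` over `1 ≤ t ≤ N`. -/
def maxG (r : Pass n E I V) (i : I) : ℝ := sSup ((fun t => |(r.lam t).g i|) '' Set.Icc 1 r.N)

/-- `λ̃_i^F`, the maximum of `‖(λ_i^{H,t}, λ_i^{G,t})‖_∞` over `1 ≤ t ≤ N`. -/
def maxF (r : Pass n E I V) (i : V) : ℝ :=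
  sSup ((fun t => max |(r.lam t).H i| |(r.lam t).G i|) '' Set.Icc 1 r.N)

open Classical in
/-- The index `t(γ)` of the segment that contains the point with parameter `γ`. -/
def seg (r : Pass n E I V) (γ : ℝ) : ℕ :=
  if γ = 1 then r.N else sInf {t | γ * r.len r.N < r.len t}

open Classical in
/-- The position `α(γ)` inside that segment. -/
def pos (r : Pass n E I V) (γ : ℝ) : ℝ :=
  if γ = 1 then 1
  else (γ * r.len r.N - r.len (r.seg γ - 1)) / (r.len (r.seg γ) - r.len (r.seg γ - 1))

/-- The point `(1 - α) s^{t-1} + α s^t` of the `t`-th segment. -/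
def onSeg (r : Pass n E I V) (t : ℕ) (α : ℝ) : Vec n := (1 - α) • r.s (t - 1) + α • r.s t

/-- The polygonal line `ŝ`, parametrized by its length. -/
def curve (r : Pass n E I V) (γ : ℝ) : Vec n := r.onSeg (r.seg γ) (r.pos γ)

end Pass

/-- Penalty parameters `(σ^h, σ^g, σ^F)`. -/
structure Penalty (E I V : Type*) where
  h : E → ℝ
  g : I → ℝ
  F : V → ℝ

section Merit

variable {n : ℕ} {E I V : Type*} [Fintype E] [Fintype I] [Fintype V]

open Classical in
/-- The merit function of the piece `V1` at the displacement `s` from `x`. -/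
def merit (P : MPVC n E I V) (σ : Penalty E I V) (V1 : Set V) (x s : Vec n) : ℝ :=
  P.f (x + s) + ∑ i, σ.h i * |P.h i (x + s)| + ∑ i, σ.g i * max 0 (P.g i (x + s))
    + ∑ i, σ.F i * dist1 (-P.H i (x + s), P.G i (x + s)) (if i ∈ V1 then setP1 else setP2)

open Classical in
/-- The first order model of the merit function of the piece `V1`; `fx` is the value `f x`. -/
def modelMerit (q : AuxData n E I V) (fx : ℝ) (σ : Penalty E I V) (V1 : Set V) (s : Vec n) : ℝ :=
  fx + inner ℝ q.df s + (1 / 2) * inner ℝ s (q.opB s)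
    + ∑ i, σ.h i * |q.h i + inner ℝ (q.dh i) s|
    + ∑ i, σ.g i * max 0 (q.g i + inner ℝ (q.dg i) s)
    + ∑ i, σ.F i * dist1 (q.F i + q.dF i s) (if i ∈ V1 then setP1 else setP2)

/-- The line search function `Y(γ)`. -/
def lineY (P : MPVC n E I V) (σ : Penalty E I V) (x : Vec n) (r : Pass n E I V) (γ : ℝ) : ℝ :=
  merit P σ (r.V1 (r.seg γ)) x (r.curve γ)

/-- The line search function `Z(γ)`, which interpolates the model linearly on each segment. -/
def lineZ (q : AuxData n E I V) (fx : ℝ) (σ : Penalty E I V) (r : Pass n E I V) (γ : ℝ) : ℝ :=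
  (1 - r.pos γ) * modelMerit q fx σ (r.V1 (r.seg γ)) (r.onSeg (r.seg γ) 0)
    + r.pos γ * modelMerit q fx σ (r.V1 (r.seg γ)) (r.onSeg (r.seg γ) 1)

end Merit

/-- The constants of the SQP method. -/
structure Params where
  ζ : ℝ
  ρbar : ℝ
  ξ₁ : ℝ
  ξ₂ : ℝ
  ξ : ℝ
  γlo : ℝ
  γhi : ℝ
  ζ_pos : 0 < ζ
  ζ_lt : ζ < 1
  one_lt_ρbar : 1 < ρbar
  one_lt_ξ₁ : 1 < ξ₁
  ξ₁_lt_ξ₂ : ξ₁ < ξ₂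
  ξ_pos : 0 < ξ
  ξ_lt : ξ < 1
  γlo_pos : 0 < γlo
  γlo_le : γlo ≤ γhi
  γhi_lt : γhi < 1

/-- The quantities generated by the SQP method. In iteration `k`:
`x k`, `B k`, `ρ k` are the iterate, the matrix and the penalty passed to the auxiliary solver;
`pass k` is the last pass of the auxiliary solver; `lamM k` is a multiplier for the last test piece
at its final point; `σ k` are the penalty parameters before the update and `σ (k + 1)` those after
it; `γ k` is the sequence of trial parameters (indexed from `0`), and `j k` is the index of the
accepted one. -/
structure Iterates (n : ℕ) (E I V : Type*) where
  x : ℕ → Vec n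
  B : ℕ → Matrix (Fin n) (Fin n) ℝ
  ρ : ℕ → ℝ
  σ : ℕ → Penalty E I V
  pass : ℕ → Pass n E I V
  lamM : ℕ → Multiplier E I V
  γ : ℕ → ℕ → ℝ
  j : ℕ → ℕ

namespace Iterates

variable {n : ℕ} {E I V : Type*}

/-- The auxiliary data of iteration `k`. -/
def aux (a : Iterates n E I V) (P : MPVC n E I V) (k : ℕ) : AuxData n E I V :=
  P.auxData (a.B k) (a.x k)

/-- The penalty update: `σ` is replaced by `ξ₂ * l` if `σ < ξ₁ * l`, and kept otherwise. -/
def penaltyUpdate (p : Params) (σ l : ℝ) : ℝ :=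
  open Classical in if σ < p.ξ₁ * l then p.ξ₂ * l else σ

/-- The acceptance test of the line search in iteration `k` for the parameter `γ`. -/
def Accepts [Fintype E] [Fintype I] [Fintype V] (a : Iterates n E I V) (P : MPVC n E I V)
    (p : Params) (k : ℕ) (γ : ℝ) : Prop :=
  lineY P (a.σ (k + 1)) (a.x k) (a.pass k) γ - lineY P (a.σ (k + 1)) (a.x k) (a.pass k) 0
    ≤ p.ξ * (lineZ (a.aux P k) (P.f (a.x k)) (a.σ (k + 1)) (a.pass k) γ
        - lineZ (a.aux P k) (P.f (a.x k)) (a.σ (k + 1)) (a.pass k) 0)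

/-- `a` is an infinite sequence generated by the basic SQP method for `P` with constants `p`,
the method never being stopped. -/
structure IsGenerated [Fintype E] [Fintype I] [Fintype V] (a : Iterates n E I V)
    (P : MPVC n E I V) (p : Params) : Prop where
  ρ_zero_pos : 0 < a.ρ 0
  σ_init_pos : (∀ i, 0 < (a.σ 0).h i) ∧ (∀ i, 0 < (a.σ 0).g i) ∧ (∀ i, 0 < (a.σ 0).F i)
  posDef : ∀ k, (a.B k).PosDef
  solver : ∀ k, (a.pass k).IsSolverOutcome (a.aux P k) p.ζ p.ρbar (a.ρ k) (a.ρ (k + 1))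
  multiplier : ∀ k, (a.aux P k).IsKKT (a.ρ (k + 1))
    ((a.aux P k).I1 ((a.pass k).pt (a.pass k).N) ∪ (a.aux P k).I00 ((a.pass k).pt (a.pass k).N))
    ((a.pass k).pt (a.pass k).N) (a.lamM k)
  not_stopped : ∀ k, (a.pass k).s (a.pass k).N ≠ 0
  penalty_h : ∀ k i, (a.σ (k + 1)).h i = penaltyUpdate p ((a.σ k).h i) ((a.pass k).maxH i)
  penalty_g : ∀ k i, (a.σ (k + 1)).g i = penaltyUpdate p ((a.σ k).g i) ((a.pass k).maxG i)
  penalty_F : ∀ k i, (a.σ (k + 1)).F i = penaltyUpdate p ((a.σ k).F i) ((a.pass k).maxF i)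
  γ_zero : ∀ k, a.γ k 0 = 1
  γ_pos : ∀ k j, 0 < a.γ k j
  γ_ratio : ∀ k j, p.γlo ≤ a.γ k (j + 1) / a.γ k j ∧ a.γ k (j + 1) / a.γ k j ≤ p.γhi
  j_least : ∀ k, IsLeast {j | a.Accepts P p k (a.γ k j)} (a.j k)
  step : ∀ k, a.x (k + 1) = a.x k + (a.pass k).curve (a.γ k (a.j k))

/-- The standing boundedness assumption: the iterates, the lengths of the polygonal lines and the
multipliers are bounded, and the matrices are bounded and uniformly positive definite. -/
structure IsBounded (a : Iterates n E I V) : Prop where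
  x_bdd : ∃ C, ∀ k, ‖a.x k‖ ≤ C
  len_bdd : ∃ C, ∀ k, (a.pass k).len (a.pass k).N ≤ C
  /-- The multipliers `λ^t`, `1 ≤ t ≤ N`, of all pieces. -/
  lam_bdd : ∃ C, ∀ k, (∀ i, (a.pass k).maxH i ≤ C) ∧ (∀ i, (a.pass k).maxG i ≤ C) ∧
    (∀ i, (a.pass k).maxF i ≤ C)
  /-- The multipliers for the last test piece at the final point. -/
  lamM_bdd : ∃ C, ∀ k, (∀ i, |(a.lamM k).h i| ≤ C) ∧ (∀ i, |(a.lamM k).g i| ≤ C) ∧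
    (∀ i, |(a.lamM k).H i| ≤ C ∧ |(a.lamM k).G i| ≤ C)
  /-- Every eigenvalue of every `B k` is at least `c > 0`. -/
  eig_lower : ∃ c > 0, ∀ k, ∀ μ ∈ spectrum ℝ (a.B k), c ≤ μ
  norm_bdd : ∃ C, ∀ k, ‖Matrix.toEuclideanCLM (𝕜 := ℝ) (a.B k)‖ ≤ C

end Iterates

end VanishingConstraints

end

/-!
A point `(s, δ)` that is feasible for a convex piece of the relaxed quadratic program reduces the
linearized violation of every constraint, measured by the distance to the convex piece, to at most
`δ` times the present violation, measured by the distance to the whole set `setP`. Hence, for an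
arbitrary piece, the model of the merit function at `s` is at most the penalized model
`∇f s + ½ sᵀBs + δ K`, where `K = infeas` is the weighted violation at the iterate
(`AuxData.IsFeasible.modelMerit_le`). The right-hand side does not depend on the piece, so the
solver may change pieces freely. If the penalties dominate the multipliers, the KKT conditions give
a decrease by `c/2 ‖s^t - s^{t-1}‖²` of the penalized model on each segment
(`AuxData.IsKKT.penModel_le`), and so the function `Z` of the line search decreases by at least
`c/2` times the `energy` of the path (`Pass.IsPass.lineZ_le`).

The function `Y` exceeds `Z` by at most the linearization error, as the model is convex on each
piece. This error is merely `o(γ)`, while the energy may be quadratic in `γ` at the start of the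
path. The way out is that the number of segments is bounded (`Pass.IsPass.N_le`), so on a path of
length at least `β` there is a long segment that comes after a much shorter initial part. On that
segment the energy grows linearly, which forces a step size and an energy bounded below
(`Iterates.IsGenerated.exists_energy_ge`).

The penalties are eventually constant, and from then on the exact merit function, which penalizes
the distance to `setP`, decreases by a multiple of the energy in each iteration. As it is bounded
below on bounded sets, the energies tend to zero, and so do the lengths of the paths
(`Iterates.IsGenerated.tendsto_len`). Since `δ < ζ < 1`, the relaxation scales constraint values
only by factors at least `1 - ζ`, and feasibility and M-stationarity of the limit follow from
feasibility and the KKT conditions for the piece `I¹ ∪ I⁰⁰` (`MPVC.isMStationary_of_tendsto`).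
-/

open Filter Topology

namespace VanishingConstraints

/-! ### The `ℓ¹` distance in the plane -/

lemma dist1_bddBelow (u : ℝ × ℝ) (A : Set (ℝ × ℝ)) :
    BddBelow (Set.range fun v : A => |u.1 - v.1.1| + |u.2 - v.1.2|) :=
  ⟨0, by rintro _ ⟨v, rfl⟩; positivity⟩

lemma dist1_nonneg (u : ℝ × ℝ) (A : Set (ℝ × ℝ)) : 0 ≤ dist1 u A :=
  Real.iInf_nonneg fun _ => by positivity

lemma dist1_le (u : ℝ × ℝ) {A : Set (ℝ × ℝ)} {v : ℝ × ℝ} (hv : v ∈ A) :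
    dist1 u A ≤ |u.1 - v.1| + |u.2 - v.2| :=
  ciInf_le (dist1_bddBelow u A) ⟨v, hv⟩

lemma le_dist1 {u : ℝ × ℝ} {A : Set (ℝ × ℝ)} (hA : A.Nonempty) {c : ℝ}
    (h : ∀ v ∈ A, c ≤ |u.1 - v.1| + |u.2 - v.2|) : c ≤ dist1 u A :=
  haveI := hA.to_subtype
  le_ciInf fun v => h v.1 v.2

lemma dist1_anti (u : ℝ × ℝ) {A A' : Set (ℝ × ℝ)} (hA : A.Nonempty) (h : A ⊆ A') :
    dist1 u A' ≤ dist1 u A :=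
  le_dist1 hA fun _ hv => dist1_le u (h hv)

lemma dist1_add_le (u w : ℝ × ℝ) {A : Set (ℝ × ℝ)} (hA : A.Nonempty) :
    dist1 (u + w) A ≤ dist1 u A + (|w.1| + |w.2|) := by
  rw [← sub_le_iff_le_add]
  refine le_dist1 hA fun v hv => ?_
  have h := dist1_le (u + w) hv
  have h1 : |(u + w).1 - v.1| ≤ |u.1 - v.1| + |w.1| := by
    rw [Prod.fst_add, add_sub_right_comm]; exact abs_add_le _ _
  have h2 : |(u + w).2 - v.2| ≤ |u.2 - v.2| + |w.2| := by
    rw [Prod.snd_add, add_sub_right_comm]; exact abs_add_le _ _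
  linarith

lemma setP1_nonempty : setP1.Nonempty := ⟨(0, 0), rfl⟩

lemma setP2_nonempty : setP2.Nonempty := ⟨(0, 0), le_rfl, le_rfl⟩

lemma setP1_subset : setP1 ⊆ setP := fun u (hu : u.1 = 0) => by simp [setP, hu]

lemma setP2_subset : setP2 ⊆ setP := fun _ hu => ⟨hu.1, mul_nonneg_of_nonpos_of_nonpos hu.1 hu.2⟩

lemma setP_subset : setP ⊆ setP1 ∪ setP2 := by
  rintro u ⟨h1, h2⟩
  rcases h1.eq_or_lt with h | h
  · exact Or.inl h
  · exact Or.inr ⟨h1, nonpos_of_mul_nonneg_right h2 h⟩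

lemma dist1_setP1 (u : ℝ × ℝ) : dist1 u setP1 = |u.1| := by
  refine le_antisymm ?_ (le_dist1 setP1_nonempty fun v (hv : v.1 = 0) => ?_)
  · simpa using dist1_le u (show ((0, u.2) : ℝ × ℝ) ∈ setP1 from rfl)
  · rw [hv, sub_zero]; linarith [abs_nonneg (u.2 - v.2)]

lemma dist1_setP2 (u : ℝ × ℝ) : dist1 u setP2 = max 0 u.1 + max 0 u.2 := by
  have key : ∀ a : ℝ, |a - min a 0| = max 0 a := fun a => by
    rcases le_total a 0 with h | h <;> simp [h, abs_of_nonneg]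
  refine le_antisymm ?_ (le_dist1 setP2_nonempty fun v hv => ?_)
  · simpa only [key] using dist1_le u (show ((min u.1 0, min u.2 0) : ℝ × ℝ) ∈ setP2 from
      ⟨min_le_right _ _, min_le_right _ _⟩)
  · have h : ∀ a b : ℝ, b ≤ 0 → max 0 a ≤ |a - b| := fun a b hb =>
      max_le (abs_nonneg _) (by linarith [le_abs_self (a - b)])
    exact add_le_add (h _ _ hv.1) (h _ _ hv.2)

lemma dist1_setP (u : ℝ × ℝ) : dist1 u setP = min (dist1 u setP1) (dist1 u setP2) := by
  refine le_antisymm (le_min (dist1_anti u setP1_nonempty setP1_subset)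
    (dist1_anti u setP2_nonempty setP2_subset)) ?_
  refine le_dist1 (setP1_nonempty.mono setP1_subset) fun v hv => ?_
  rcases setP_subset hv with h | h
  · exact (min_le_left _ _).trans (dist1_le u h)
  · exact (min_le_right _ _).trans (dist1_le u h)

lemma continuous_dist1_setP : Continuous fun u : ℝ × ℝ => dist1 u setP := by
  simp only [dist1_setP, dist1_setP1, dist1_setP2]
  fun_prop

lemma mem_setP_of_dist1_eq_zero {u : ℝ × ℝ} (h : dist1 u setP = 0) : u ∈ setP := by
  rw [dist1_setP, dist1_setP1, dist1_setP2] at h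
  rcases le_total (|u.1|) (max 0 u.1 + max 0 u.2) with h' | h'
  · rw [min_eq_left h'] at h
    exact setP1_subset (abs_eq_zero.1 h)
  · rw [min_eq_right h'] at h
    have := le_max_left 0 u.1
    have := le_max_left 0 u.2
    exact setP2_subset ⟨by linarith [le_max_right 0 u.1], by linarith [le_max_right 0 u.2]⟩

lemma piece_nonempty (c : Prop) [Decidable c] : (if c then setP1 else setP2).Nonempty := by
  split_ifs
  exacts [setP1_nonempty, setP2_nonempty]

lemma piece_subset (c : Prop) [Decidable c] : (if c then setP1 else setP2) ⊆ setP := by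
  split_ifs
  exacts [setP1_subset, setP2_subset]

lemma max_zero_convex {a b α : ℝ} (h0 : 0 ≤ α) (h1 : α ≤ 1) :
    max 0 ((1 - α) * a + α * b) ≤ (1 - α) * max 0 a + α * max 0 b := by
  have h1' : 0 ≤ 1 - α := by linarith
  exact max_le (by positivity) (add_le_add
    (mul_le_mul_of_nonneg_left (le_max_right _ _) h1')
    (mul_le_mul_of_nonneg_left (le_max_right _ _) h0))

lemma abs_convex {a b α : ℝ} (h0 : 0 ≤ α) (h1 : α ≤ 1) :
    |(1 - α) * a + α * b| ≤ (1 - α) * |a| + α * |b| := by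
  have h1' : 0 ≤ 1 - α := by linarith
  refine (abs_add_le _ _).trans_eq ?_
  rw [abs_mul, abs_mul, abs_of_nonneg h0, abs_of_nonneg h1']

lemma dist1_piece_convex (c : Prop) [Decidable c] (u v : ℝ × ℝ) {α : ℝ} (h0 : 0 ≤ α)
    (h1 : α ≤ 1) :
    dist1 ((1 - α) • u + α • v) (if c then setP1 else setP2)
      ≤ (1 - α) * dist1 u (if c then setP1 else setP2)
        + α * dist1 v (if c then setP1 else setP2) := by
  split_ifs
  · simpa [dist1_setP1] using abs_convex h0 h1
  · have e1 := max_zero_convex (a := u.1) (b := v.1) h0 h1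
    have e2 := max_zero_convex (a := u.2) (b := v.2) h0 h1
    simp only [dist1_setP2, Prod.fst_add, Prod.snd_add, Prod.smul_fst, Prod.smul_snd, smul_eq_mul]
    linarith

lemma normalCone_setP1 {u z : ℝ × ℝ} (h : z ∈ normalCone setP1 u) : u.1 = 0 ∧ z.2 = 0 := by
  obtain ⟨hu, h⟩ := h
  have hu' : u.1 = 0 := hu
  refine ⟨hu', ?_⟩
  have h1 := h (0, u.2 + z.2) rfl
  simp only [hu', sub_self, mul_zero, zero_add, add_sub_cancel_left] at h1
  exact mul_self_eq_zero.1 (le_antisymm h1 (mul_self_nonneg _))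

lemma normalCone_setP2 {u z : ℝ × ℝ} (h : z ∈ normalCone setP2 u) :
    u.1 ≤ 0 ∧ u.2 ≤ 0 ∧ 0 ≤ z.1 ∧ 0 ≤ z.2 ∧ z.1 * u.1 = 0 ∧ z.2 * u.2 = 0 := by
  obtain ⟨⟨hu1, hu2⟩, h⟩ := h
  have a1 := h (u.1 - 1, u.2) ⟨by simp; linarith, hu2⟩
  have a2 := h (u.1, u.2 - 1) ⟨hu1, by simp; linarith⟩
  have a3 := h (0, u.2) ⟨le_rfl, hu2⟩
  have a4 := h (u.1, 0) ⟨hu1, le_rfl⟩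
  simp only [sub_self, mul_zero, add_zero, zero_add] at a1 a2 a3 a4
  have z1 : 0 ≤ z.1 := by linarith
  have z2 : 0 ≤ z.2 := by linarith
  have b1 := mul_nonpos_of_nonneg_of_nonpos z1 hu1
  have b2 := mul_nonpos_of_nonneg_of_nonpos z2 hu2
  exact ⟨hu1, hu2, z1, z2, by linarith, by linarith⟩

namespace AuxData

variable {n : ℕ} {E I V : Type*}

/-! ### The relaxed constraints -/

lemma thetaHG_fst_mem (q : AuxData n E I V) (i : V) :
    0 ≤ (q.thetaHG i).1 ∧ (q.thetaHG i).1 ≤ 1 := by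
  unfold thetaHG; split_ifs <;> simp

lemma thetaHG_snd_mem (q : AuxData n E I V) (i : V) :
    0 ≤ (q.thetaHG i).2 ∧ (q.thetaHG i).2 ≤ 1 := by
  unfold thetaHG; split_ifs <;> simp

lemma thetag_mem (q : AuxData n E I V) (i : I) : 0 ≤ q.thetag i ∧ q.thetag i ≤ 1 := by
  unfold thetag; split_ifs <;> simp

lemma thetag_mul (q : AuxData n E I V) (i : I) : q.thetag i * q.g i = max 0 (q.g i) := by
  unfold thetag
  split_ifs with h
  · rw [one_mul, max_eq_right h.le]
  · rw [zero_mul, max_eq_left (not_lt.1 h)]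

/-- The relaxation vector vanishes on `setP`; otherwise it leads from `F` to `setP1` or `setP2`,
whichever is nearer, along a coordinate axis. -/
lemma relax_cases (q : AuxData n E I V) (i : V) :
    (q.relax i = (0, 0) ∧ q.F i ∈ setP) ∨
    (q.relax i = (q.H i, 0) ∧ |q.H i| = dist1 (q.F i) setP) ∨
    (q.relax i = (0, -q.G i) ∧ 0 ≤ q.H i ∧ |q.G i| = dist1 (q.F i) setP) := by
  unfold relax thetaHG
  have hd := dist1_setP (q.F i)
  split_ifs with h1 h2
  · exact Or.inl ⟨by simp, mem_setP_of_dist1_eq_zero h1⟩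
  · refine Or.inr (Or.inl ⟨by simp, ?_⟩)
    rw [hd, min_eq_left h2, dist1_setP1]
    simp [F]
  · refine Or.inr (Or.inr ?_)
    rw [hd, min_eq_right (not_le.1 h2).le] at h1
    rw [hd, min_eq_right (not_le.1 h2).le]
    rw [dist1_setP1, dist1_setP2] at h2
    rw [dist1_setP2] at h1 ⊢
    simp only [F, abs_neg] at h1 h2 ⊢
    have hH : 0 ≤ q.H i := by
      by_contra! hneg
      rw [abs_of_neg hneg, max_eq_right (by linarith)] at h2
      linarith [le_max_left 0 (q.G i)]
    rw [max_eq_left (by linarith : -q.H i ≤ 0), zero_add] at h1 ⊢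
    have hG : 0 ≤ q.G i := by
      by_contra! hneg
      exact h1 (max_eq_left hneg.le)
    exact ⟨by simp, hH, by rw [abs_of_nonneg hG, max_eq_right hG]⟩

/-- The `ℓ¹` norm of the relaxation vector is the violation of the vanishing constraint; this is why
`δ` measures the violation that remains. -/
lemma relax_norm_le (q : AuxData n E I V) (i : V) :
    |(q.relax i).1| + |(q.relax i).2| ≤ dist1 (q.F i) setP := by
  have h0 := dist1_nonneg (q.F i) setP
  rcases q.relax_cases i with ⟨h, -⟩ | ⟨h, h'⟩ | ⟨h, -, h'⟩
  · simpa [h] using h0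
  · simp [h, h']
  · simp [h, h']

lemma relaxedF_fst (q : AuxData n E I V) (z : Vec n × ℝ) (i : V) :
    (q.relaxedF z i).1 = z.2 * (q.relax i).1 - q.H i - inner ℝ (q.dH i) z.1 := by
  simp [relaxedF, F, dF]; ring

lemma relaxedF_snd (q : AuxData n E I V) (z : Vec n × ℝ) (i : V) :
    (q.relaxedF z i).2 = z.2 * (q.relax i).2 + q.G i + inner ℝ (q.dG i) z.1 := by
  simp [relaxedF, F, dF]

lemma relaxedF_fst' (q : AuxData n E I V) (z : Vec n × ℝ) (i : V) :
    (q.relaxedF z i).1 = -((1 - z.2 * (q.thetaHG i).1) * q.H i) - inner ℝ (q.dH i) z.1 := by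
  rw [relaxedF_fst, relax]; ring

lemma relaxedF_snd' (q : AuxData n E I V) (z : Vec n × ℝ) (i : V) :
    (q.relaxedF z i).2 = (1 - z.2 * (q.thetaHG i).2) * q.G i + inner ℝ (q.dG i) z.1 := by
  rw [relaxedF_snd, relax]; ring

lemma relaxedF_zero_one_mem (q : AuxData n E I V) (i : V) :
    q.relaxedF (0, 1) i ∈ setP1 ∪ setP2 := by
  have h : q.relaxedF (0, 1) i = q.relax i + q.F i := by
    ext <;> simp [relaxedF, dF]
  rw [h]
  rcases q.relax_cases i with ⟨h, hF⟩ | ⟨h, -⟩ | ⟨h, hH, -⟩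
  · rw [h, show ((0, 0) : ℝ × ℝ) = 0 from rfl, zero_add]
    exact setP_subset hF
  · left
    simp [setP1, h, F]
  · right
    simp [setP2, h, F, hH]

lemma IsFeasible.relaxedF_mem {q : AuxData n E I V} {V1 : Set V} {z : Vec n × ℝ}
    (hz : q.IsFeasible V1 z) (i : V) : q.relaxedF z i ∈ setP1 ∪ setP2 := by
  by_cases h : i ∈ V1
  · exact Or.inl (hz.mem_P1 i h)
  · exact Or.inr (hz.mem_P2 i h)

lemma mem_setP_of_between {q : AuxData n E I V} {W : Set V} {z : Vec n × ℝ}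
    (hP : ∀ i, q.relaxedF z i ∈ setP1 ∪ setP2) (h1 : q.I1 z ⊆ W) (h2 : W ⊆ q.I1 z ∪ q.I00 z) :
    (∀ i ∈ W, q.relaxedF z i ∈ setP1) ∧ ∀ i ∉ W, q.relaxedF z i ∈ setP2 := by
  refine ⟨fun i hi => ?_, fun i hi => ?_⟩
  · rcases h2 hi with h | h
    · exact h.1
    · rw [show q.relaxedF z i = (0, 0) from h]; rfl
  · rcases hP i with h | h
    · by_contra h'
      exact hi (h1 ⟨h, h'⟩)
    · exact h

/-- A point that is feasible for one piece is feasible for every piece between `I¹` and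
`I¹ ∪ I⁰⁰`: only constraints that sit at the kink of `setP` are reassigned. -/
lemma IsFeasible.of_between {q : AuxData n E I V} {V1 W : Set V} {z : Vec n × ℝ}
    (hz : q.IsFeasible V1 z) (h1 : q.I1 z ⊆ W) (h2 : W ⊆ q.I1 z ∪ q.I00 z) :
    q.IsFeasible W z :=
  ⟨hz.eq_h, hz.le_g, (mem_setP_of_between hz.relaxedF_mem h1 h2).1,
    (mem_setP_of_between hz.relaxedF_mem h1 h2).2, hz.nonneg⟩

/-- At `δ = 1` all constraints are fully relaxed, so the starting point is feasible. -/
lemma isFeasible_zero_one (q : AuxData n E I V) : q.IsFeasible (q.I1 (0, 1)) (0, 1) := by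
  have h := mem_setP_of_between q.relaxedF_zero_one_mem subset_rfl Set.subset_union_left
  refine ⟨fun i => by simp, fun i => ?_, h.1, h.2, zero_le_one⟩
  have := q.thetag_mul i
  have := le_max_right 0 (q.g i)
  simp only [inner_zero_right]
  linarith

lemma I1_subset_testPieces (q : AuxData n E I V) (z : Vec n × ℝ) (V1 : Set V) (j : Fin 4) :
    q.I1 z ⊆ q.testPieces z V1 j := by
  fin_cases j <;> simp [testPieces]

lemma testPieces_subset (q : AuxData n E I V) (z : Vec n × ℝ) (V1 : Set V) (j : Fin 4) :
    q.testPieces z V1 j ⊆ q.I1 z ∪ q.I00 z := by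
  fin_cases j <;> simp only [testPieces] <;> intro i hi <;> simp at hi ⊢ <;> tauto

/-! ### The quadratic programs -/

lemma inner_opB_comm {q : AuxData n E I V} (hB : q.B.PosDef) (s s' : Vec n) :
    inner ℝ s (q.opB s') = inner ℝ (q.opB s) s' := by
  have h : IsSelfAdjoint q.opB := by
    unfold opB
    rw [isSelfAdjoint_iff, ← map_star, Matrix.star_eq_conjTranspose, hB.1.eq]
  exact (ContinuousLinearMap.isSelfAdjoint_iff_isSymmetric.1 h s s').symm

/-- Uniform positivity of the matrix, from its smallest eigenvalue. -/
lemma inner_opB_ge {q : AuxData n E I V} (hB : q.B.PosDef) {c : ℝ}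
    (hc : ∀ μ ∈ spectrum ℝ q.B, c ≤ μ) (s : Vec n) : c * ‖s‖ ^ 2 ≤ inner ℝ s (q.opB s) := by
  have h : (q.B - c • (1 : Matrix (Fin n) (Fin n) ℝ)).PosSemidef := by
    have hH : (q.B - c • (1 : Matrix (Fin n) (Fin n) ℝ)).IsHermitian := by
      refine hB.1.sub ?_
      simp [Matrix.IsHermitian]
    rw [hH.posSemidef_iff_eigenvalues_nonneg]
    intro i
    have h1 := hH.eigenvalues_mem_spectrum_real i
    have h2 : c + hH.eigenvalues i ∈ spectrum ℝ q.B := by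
      rw [add_comm, spectrum.add_mem_iff, Algebra.algebraMap_eq_smul_one, neg_add_eq_sub]
      exact h1
    have := hc _ h2
    simp only [Pi.zero_apply]
    linarith
  have h2 := h.dotProduct_mulVec_nonneg s.ofLp
  have h3 : inner ℝ s s = s.ofLp ⬝ᵥ s.ofLp := by
    rw [EuclideanSpace.inner_eq_star_dotProduct, star_trivial]
  rw [Matrix.sub_mulVec, dotProduct_sub, Matrix.smul_mulVec, Matrix.one_mulVec, star_trivial,
    dotProduct_smul, ← h3, real_inner_self_eq_norm_sq, smul_eq_mul] at h2
  rw [opB, Matrix.inner_toEuclideanCLM]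
  linarith

lemma quad_expand {q : AuxData n E I V} (hB : q.B.PosDef) (s s' : Vec n) :
    inner ℝ s' (q.opB s') = inner ℝ s (q.opB s) + 2 * inner ℝ (q.opB s) (s' - s)
      + inner ℝ (s' - s) (q.opB (s' - s)) := by
  have h1 := inner_opB_comm hB s s'
  have h2 := real_inner_comm (q.opB s) s
  have h3 := inner_opB_comm hB s' s
  have h4 := real_inner_comm (q.opB s) s'
  simp only [map_sub, inner_sub_left, inner_sub_right]
  linarith

lemma IsFeasible.dist1_le {q : AuxData n E I V} {V1 : Set V} {z : Vec n × ℝ}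
    (hz : q.IsFeasible V1 z) (i : V) (inst : Decidable (i ∈ V1)) :
    dist1 (q.F i + q.dF i z.1) (if i ∈ V1 then setP1 else setP2)
      ≤ dist1 (q.F i) setP * z.2 := by
  have hm : q.relaxedF z i ∈ (if i ∈ V1 then setP1 else setP2) := by
    split_ifs with h
    exacts [hz.mem_P1 i h, hz.mem_P2 i h]
  refine (VanishingConstraints.dist1_le _ hm).trans ?_
  have h1 : ∀ a b c : ℝ, a + b - (c + a + b) = -c := fun a b c => by ring
  simp only [relaxedF, Prod.fst_add, Prod.snd_add, h1, Prod.smul_fst, Prod.smul_snd, abs_neg,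
    smul_eq_mul, abs_mul, abs_of_nonneg hz.nonneg]
  rw [← mul_add, mul_comm]
  exact mul_le_mul_of_nonneg_right (q.relax_norm_le i) hz.nonneg

variable [Fintype E] [Fintype I] [Fintype V]

/-- The first-order consequence of the KKT conditions: comparison of a solution `z` of a piece with
another feasible point `w` of the same piece. -/
lemma IsKKT.variational {q : AuxData n E I V} {ρ : ℝ} {V1 : Set V} {z w : Vec n × ℝ}
    {l : Multiplier E I V} (hz : q.IsFeasible V1 z) (hl : q.IsKKT ρ V1 z l)
    (hw : q.IsFeasible V1 w) :
    0 ≤ inner ℝ q.df (w.1 - z.1) + inner ℝ (q.opB z.1) (w.1 - z.1)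
      + (w.2 - z.2) * (∑ i, l.h i * q.h i + ∑ i, l.g i * q.thetag i * q.g i
        - ∑ i, ((q.relax i).1 * l.H i + (q.relax i).2 * l.G i)) := by
  obtain ⟨hst, -, hg, hP1, hP2⟩ := hl
  have h0 := congrArg (fun v => inner ℝ v (w.1 - z.1)) hst
  simp only [inner_add_left, sum_inner, real_inner_smul_left, inner_neg_left, inner_zero_left]
    at h0
  have eh : ∑ i, l.h i * inner ℝ (q.dh i) (w.1 - z.1) = (w.2 - z.2) * ∑ i, l.h i * q.h i := by
    rw [Finset.mul_sum]
    refine Finset.sum_congr rfl fun i _ => ?_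
    rw [inner_sub_right]
    linear_combination l.h i * (hw.eq_h i) - l.h i * (hz.eq_h i)
  have eg : ∑ i, l.g i * inner ℝ (q.dg i) (w.1 - z.1)
      ≤ (w.2 - z.2) * ∑ i, l.g i * q.thetag i * q.g i := by
    rw [Finset.mul_sum]
    refine Finset.sum_le_sum fun i _ => ?_
    rw [inner_sub_right]
    have h1 := mul_nonpos_of_nonneg_of_nonpos (hg i).2 (hw.le_g i)
    have h2 := (hg i).1
    linarith
  have eF : ∑ i, (-(l.H i * inner ℝ (q.dH i) (w.1 - z.1)) + l.G i * inner ℝ (q.dG i) (w.1 - z.1))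
      ≤ (w.2 - z.2) * -∑ i, ((q.relax i).1 * l.H i + (q.relax i).2 * l.G i) := by
    rw [← Finset.sum_neg_distrib, Finset.mul_sum]
    refine Finset.sum_le_sum fun i _ => ?_
    have h1 : l.H i * ((q.relaxedF w i).1 - (q.relaxedF z i).1)
        + l.G i * ((q.relaxedF w i).2 - (q.relaxedF z i).2) ≤ 0 := by
      by_cases hi : i ∈ V1
      · exact (hP1 i hi).2 _ (hw.mem_P1 i hi)
      · exact (hP2 i hi).2 _ (hw.mem_P2 i hi)
    simp only [relaxedF_fst, relaxedF_snd] at h1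
    simp only [inner_sub_right]
    linarith
  linarith

/-- A KKT point is the only solution of its piece, with quadratic growth of the objective. -/
lemma IsKKT.objective_lt {q : AuxData n E I V} (hB : q.B.PosDef) {ρ c : ℝ} (hρ : 0 < ρ)
    (hc0 : 0 < c) (hc : ∀ s : Vec n, c * ‖s‖ ^ 2 ≤ inner ℝ s (q.opB s))
    {V1 : Set V} {z w : Vec n × ℝ}
    {l : Multiplier E I V} (hz : q.IsFeasible V1 z) (hl : q.IsKKT ρ V1 z l)
    (hw : q.IsFeasible V1 w) (hne : w ≠ z) : q.objective ρ z < q.objective ρ w := by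
  have hv := hl.variational hz hw
  obtain ⟨-, ⟨lδ, hlδ, hlδ0, heq⟩, -⟩ := hl
  have e : ∑ i, l.h i * q.h i + ∑ i, l.g i * q.thetag i * q.g i
        - ∑ i, ((q.relax i).1 * l.H i + (q.relax i).2 * l.G i) = ρ * (z.2 + 1) - lδ := by linarith
  rw [e] at hv
  have h1 := mul_nonneg hlδ hw.nonneg
  have h2 := quad_expand hB z.1 w.1
  have h3 := hc (w.1 - z.1)
  have h4 : 0 < 1 / 2 * (c * ‖w.1 - z.1‖ ^ 2) + 1 / 2 * (ρ * (w.2 - z.2) ^ 2) := by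
    by_cases h : w.1 = z.1
    · have h' : w.2 - z.2 ≠ 0 := fun h' => hne (Prod.ext h (sub_eq_zero.1 h'))
      positivity
    · have h' : 0 < ‖w.1 - z.1‖ := norm_pos_iff.2 (sub_ne_zero.2 h)
      positivity
  unfold objective
  rw [h2]
  rw [inner_sub_right q.df] at hv
  nlinarith

/-! ### The penalized model -/

/-- The weighted constraint violation at the current point; the vanishing constraints
are measured by the distance to the whole set `setP`. -/
noncomputable def infeas (q : AuxData n E I V) (σ : Penalty E I V) : ℝ :=
  ∑ i, σ.h i * |q.h i| + ∑ i, σ.g i * max 0 (q.g i) + ∑ i, σ.F i * dist1 (q.F i) setP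

/-- The penalized quadratic model: a linear penalty in the relaxation variable `δ`, weighted by the
current constraint violation. It bounds the models of all pieces at their feasible points. -/
noncomputable def penModel (q : AuxData n E I V) (σ : Penalty E I V) (z : Vec n × ℝ) : ℝ :=
  inner ℝ q.df z.1 + (1 / 2) * inner ℝ z.1 (q.opB z.1) + q.infeas σ * z.2

/-- At a feasible point of a piece, the model of that piece is bounded by the penalized model. -/
lemma IsFeasible.modelMerit_le {q : AuxData n E I V} {σ : Penalty E I V}
    (hh : ∀ i, 0 ≤ σ.h i) (hg : ∀ i, 0 ≤ σ.g i) (hF : ∀ i, 0 ≤ σ.F i) (fx : ℝ)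
    {V1 : Set V} {z : Vec n × ℝ} (hz : q.IsFeasible V1 z) :
    modelMerit q fx σ V1 z.1 ≤ fx + q.penModel σ z := by
  unfold modelMerit penModel infeas
  have e1 : ∑ i, σ.h i * |q.h i + inner ℝ (q.dh i) z.1| ≤ (∑ i, σ.h i * |q.h i|) * z.2 := by
    rw [Finset.sum_mul]
    refine Finset.sum_le_sum fun i _ => ?_
    rw [mul_assoc]
    refine mul_le_mul_of_nonneg_left ?_ (hh i)
    rw [show q.h i + inner ℝ (q.dh i) z.1 = q.h i * z.2 by linarith [hz.eq_h i], abs_mul,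
      abs_of_nonneg hz.nonneg]
  have e2 : ∑ i, σ.g i * max 0 (q.g i + inner ℝ (q.dg i) z.1)
      ≤ (∑ i, σ.g i * max 0 (q.g i)) * z.2 := by
    rw [Finset.sum_mul]
    refine Finset.sum_le_sum fun i _ => ?_
    rw [mul_assoc]
    refine mul_le_mul_of_nonneg_left (max_le (mul_nonneg (le_max_left _ _) hz.nonneg) ?_) (hg i)
    rw [← q.thetag_mul]
    linarith [hz.le_g i]
  have e3 := Finset.sum_le_sum fun (i : V) (_ : i ∈ Finset.univ) =>
    mul_le_mul_of_nonneg_left (hz.dist1_le i (Classical.propDecidable _)) (hF i)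
  simp only [← mul_assoc] at e3
  rw [← Finset.sum_mul] at e3
  linarith

/-- Decrease of the penalized model from a feasible point `w` to a KKT point `z` of the same piece,
if the relaxation variable does not increase and the penalties dominate the multipliers. -/
lemma IsKKT.penModel_le {q : AuxData n E I V} (hB : q.B.PosDef) {ρ c : ℝ} {σ : Penalty E I V}
    (hc : ∀ s : Vec n, c * ‖s‖ ^ 2 ≤ inner ℝ s (q.opB s))
    {V1 : Set V} {z w : Vec n × ℝ} {l : Multiplier E I V} (hz : q.IsFeasible V1 z)
    (hl : q.IsKKT ρ V1 z l) (hw : q.IsFeasible V1 w) (hδ : z.2 ≤ w.2)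
    (hh : ∀ i, |l.h i| ≤ σ.h i) (hg : ∀ i, |l.g i| ≤ σ.g i)
    (hF : ∀ i, max |l.H i| |l.G i| ≤ σ.F i) :
    q.penModel σ z ≤ q.penModel σ w - c / 2 * ‖z.1 - w.1‖ ^ 2 := by
  have hv := hl.variational hz hw
  have h1 : ∑ i, l.h i * q.h i + ∑ i, l.g i * q.thetag i * q.g i
      - ∑ i, ((q.relax i).1 * l.H i + (q.relax i).2 * l.G i) ≤ q.infeas σ := by
    unfold infeas
    rw [sub_eq_add_neg, ← Finset.sum_neg_distrib]
    refine add_le_add (add_le_add ?_ ?_) ?_ <;> refine Finset.sum_le_sum fun i _ => ?_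
    · refine (le_abs_self _).trans ?_
      rw [abs_mul]
      exact mul_le_mul_of_nonneg_right (hh i) (abs_nonneg _)
    · rw [mul_assoc, thetag_mul]
      exact mul_le_mul_of_nonneg_right ((le_abs_self _).trans (hg i)) (le_max_left _ _)
    · have a1 := (le_max_left _ _).trans (hF i)
      have a2 := (le_max_right _ _).trans (hF i)
      have a0 := (abs_nonneg _).trans a1
      calc -((q.relax i).1 * l.H i + (q.relax i).2 * l.G i)
          ≤ |(q.relax i).1 * l.H i + (q.relax i).2 * l.G i| := neg_le_abs _
        _ ≤ |(q.relax i).1| * |l.H i| + |(q.relax i).2| * |l.G i| := by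
            rw [← abs_mul, ← abs_mul]; exact abs_add_le _ _
        _ ≤ |(q.relax i).1| * σ.F i + |(q.relax i).2| * σ.F i := by gcongr
        _ = σ.F i * (|(q.relax i).1| + |(q.relax i).2|) := by ring
        _ ≤ _ := mul_le_mul_of_nonneg_left (q.relax_norm_le i) a0
  have h2 := quad_expand hB z.1 w.1
  have h3 := hc (w.1 - z.1)
  have h4 := mul_le_mul_of_nonneg_left h1 (sub_nonneg.2 hδ)
  rw [norm_sub_rev]
  unfold penModel
  rw [h2]
  rw [inner_sub_right q.df] at hv
  linarith

end AuxData

namespace Pass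

/-! ### One pass of the auxiliary solver -/

section Path

variable {n : ℕ} {E I V : Type*} (r : Pass n E I V)

lemma len_zero : r.len 0 = 0 := by simp [len]

lemma len_pred_add {t : ℕ} (ht : 1 ≤ t) :
    r.len t = r.len (t - 1) + ‖r.s t - r.s (t - 1)‖ := by
  obtain ⟨t, rfl⟩ := Nat.exists_eq_add_of_le' ht
  rw [len, Finset.sum_Icc_succ_top ht, Nat.add_sub_cancel, len]

lemma len_mono : Monotone r.len := monotone_nat_of_le_succ fun t => by
  rw [r.len_pred_add (Nat.le_add_left 1 t), Nat.add_sub_cancel]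
  exact le_add_of_nonneg_right (norm_nonneg _)

lemma len_nonneg (t : ℕ) : 0 ≤ r.len t := r.len_zero.symm.trans_le (r.len_mono t.zero_le)

lemma norm_s_le_len (h0 : r.s 0 = 0) (t : ℕ) : ‖r.s t‖ ≤ r.len t := by
  induction t with
  | zero => simp [h0, len_zero]
  | succ t ih =>
    rw [r.len_pred_add (Nat.le_add_left 1 t), Nat.add_sub_cancel]
    calc ‖r.s (t + 1)‖ = ‖r.s t + (r.s (t + 1) - r.s t)‖ := by rw [add_sub_cancel]
      _ ≤ _ := (norm_add_le _ _).trans (by gcongr)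

lemma seg_of_lt_one {γ : ℝ} (hγ : γ < 1) (hS : 0 < r.len r.N) (h0 : 0 ≤ γ) :
    1 ≤ r.seg γ ∧ r.seg γ ≤ r.N ∧ γ * r.len r.N < r.len (r.seg γ) ∧
      r.len (r.seg γ - 1) ≤ γ * r.len r.N := by
  have hmem : r.N ∈ {t | γ * r.len r.N < r.len t} := mul_lt_of_lt_one_left hS hγ
  have e : r.seg γ = sInf {t | γ * r.len r.N < r.len t} := by rw [seg, if_neg hγ.ne]
  rw [e]
  have h1 : γ * r.len r.N < r.len (sInf {t | γ * r.len r.N < r.len t}) := Nat.sInf_mem ⟨_, hmem⟩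
  have h2 : 1 ≤ sInf {t | γ * r.len r.N < r.len t} := by
    by_contra! h
    rw [Nat.lt_one_iff.1 h, len_zero] at h1
    linarith [mul_nonneg h0 hS.le]
  refine ⟨h2, Nat.sInf_le hmem, h1, ?_⟩
  by_contra! h
  have := Nat.sInf_le (s := {t | γ * r.len r.N < r.len t}) h
  omega

/-- The parameter `γ` picks the point of the polygonal line at arc length `γ S^N`. -/
lemma seg_spec (hN : 1 ≤ r.N) {γ : ℝ} (hS : 0 < r.len r.N) (h0 : 0 ≤ γ) (h1 : γ ≤ 1) :
    1 ≤ r.seg γ ∧ r.seg γ ≤ r.N ∧ 0 ≤ r.pos γ ∧ r.pos γ ≤ 1 ∧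
      γ * r.len r.N = r.len (r.seg γ - 1) + r.pos γ * ‖r.s (r.seg γ) - r.s (r.seg γ - 1)‖ := by
  rcases h1.eq_or_lt with rfl | h1
  · have e1 : r.seg 1 = r.N := by rw [seg, if_pos rfl]
    have e2 : r.pos 1 = 1 := by rw [pos, if_pos rfl]
    rw [e1, e2, one_mul, one_mul]
    exact ⟨hN, le_rfl, zero_le_one, le_rfl, r.len_pred_add hN⟩
  · obtain ⟨a1, a2, a3, a4⟩ := r.seg_of_lt_one h1 hS h0
    have e := r.len_pred_add a1
    have e2 : r.pos γ = (γ * r.len r.N - r.len (r.seg γ - 1)) /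
        ‖r.s (r.seg γ) - r.s (r.seg γ - 1)‖ := by
      rw [pos, if_neg h1.ne, e, add_sub_cancel_left]
    have hpos : 0 < ‖r.s (r.seg γ) - r.s (r.seg γ - 1)‖ := by linarith
    rw [e2]
    refine ⟨a1, a2, div_nonneg (by linarith) hpos.le, (div_le_one hpos).2 (by linarith), ?_⟩
    rw [div_mul_cancel₀ _ hpos.ne']
    ring

lemma pos_zero (hS : 0 < r.len r.N) : r.pos 0 = 0 ∧ r.len (r.seg 0 - 1) = 0 := by
  obtain ⟨-, -, -, a4⟩ := r.seg_of_lt_one zero_lt_one hS le_rfl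
  have h : r.len (r.seg 0 - 1) = 0 := by
    rw [zero_mul] at a4
    exact a4.antisymm (r.len_nonneg _)
  refine ⟨?_, h⟩
  rw [pos, if_neg zero_ne_one, h]
  simp

lemma onSeg_eq (t : ℕ) (α : ℝ) : r.onSeg t α = r.s (t - 1) + α • (r.s t - r.s (t - 1)) := by
  unfold onSeg; module

lemma norm_curve_le (hN : 1 ≤ r.N) (h00 : r.s 0 = 0) {γ : ℝ} (hS : 0 < r.len r.N) (h0 : 0 ≤ γ)
    (h1 : γ ≤ 1) : ‖r.curve γ‖ ≤ γ * r.len r.N := by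
  obtain ⟨-, -, a3, -, a5⟩ := r.seg_spec hN hS h0 h1
  rw [a5, curve, onSeg_eq]
  refine (norm_add_le _ _).trans (add_le_add (r.norm_s_le_len h00 _) ?_)
  rw [norm_smul, Real.norm_of_nonneg a3]

/-- The sum of the squared lengths of the segments up to the parameter `γ`, the last one
interpolated linearly. -/
noncomputable def energy (γ : ℝ) : ℝ :=
  ∑ τ ∈ Finset.Icc 1 (r.seg γ - 1), ‖r.s τ - r.s (τ - 1)‖ ^ 2
    + r.pos γ * ‖r.s (r.seg γ) - r.s (r.seg γ - 1)‖ ^ 2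

lemma energy_nonneg (hN : 1 ≤ r.N) {γ : ℝ} (hS : 0 < r.len r.N) (h0 : 0 ≤ γ) (h1 : γ ≤ 1) :
    0 ≤ r.energy γ := by
  obtain ⟨-, -, a3, -, -⟩ := r.seg_spec hN hS h0 h1
  unfold energy
  positivity

/-- Past the initial part of the line before it, a long segment contributes linearly to the energy. -/
lemma energy_ge (hN : 1 ≤ r.N) {γ b m : ℝ} (hS : 0 < r.len r.N) (h0 : 0 ≤ γ)
    (h1 : γ ≤ 1) {t : ℕ} (hseg : b ≤ ‖r.s (t + 1) - r.s t‖)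
    (hm : 0 < m) (hmb : m ≤ b) (hγ : r.len t + m ≤ γ * r.len r.N) : b * m ≤ r.energy γ := by
  have hb : 0 ≤ b := hm.le.trans hmb
  obtain ⟨a1, a2, a3, a4, a5⟩ := r.seg_spec hN hS h0 h1
  have a6 := r.len_pred_add a1
  have a7 := norm_nonneg (r.s (r.seg γ) - r.s (r.seg γ - 1))
  unfold energy
  rcases lt_trichotomy (r.seg γ) (t + 1) with h | h | h
  · have h8 := r.len_mono (Nat.lt_succ_iff.1 h)
    have h9 := mul_le_of_le_one_left a7 a4
    linarith
  · rw [h, Nat.add_sub_cancel] at a5 ⊢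
    have h8 : m ≤ r.pos γ * ‖r.s (t + 1) - r.s t‖ := by linarith
    have h9 : 0 ≤ ∑ τ ∈ Finset.Icc 1 t, ‖r.s τ - r.s (τ - 1)‖ ^ 2 :=
      Finset.sum_nonneg fun _ _ => sq_nonneg _
    calc b * m ≤ ‖r.s (t + 1) - r.s t‖ * (r.pos γ * ‖r.s (t + 1) - r.s t‖) := by gcongr
      _ = r.pos γ * ‖r.s (t + 1) - r.s t‖ ^ 2 := by ring
      _ ≤ _ := le_add_of_nonneg_left h9
  · have hmem : t + 1 ∈ Finset.Icc 1 (r.seg γ - 1) := Finset.mem_Icc.2 (by omega)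
    have h8 : ‖r.s (t + 1) - r.s t‖ ^ 2
        ≤ ∑ τ ∈ Finset.Icc 1 (r.seg γ - 1), ‖r.s τ - r.s (τ - 1)‖ ^ 2 :=
      Finset.single_le_sum (f := fun τ => ‖r.s τ - r.s (τ - 1)‖ ^ 2)
        (fun _ _ => sq_nonneg _) hmem
    have h9 : 0 ≤ r.pos γ * ‖r.s (r.seg γ) - r.s (r.seg γ - 1)‖ ^ 2 := by positivity
    have h10 : b * m ≤ ‖r.s (t + 1) - r.s t‖ ^ 2 := by rw [sq]; gcongr; linarith
    linarith

/-- The penalties dominate all multipliers of the pass. -/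
def Dominated (σ : Penalty E I V) : Prop :=
  (∀ i, r.maxH i ≤ σ.h i) ∧ (∀ i, r.maxG i ≤ σ.g i) ∧ ∀ i, r.maxF i ≤ σ.F i

lemma le_sSup_image_Icc (u : ℕ → ℝ) {N t : ℕ} (h1 : 1 ≤ t) (h2 : t ≤ N) :
    u t ≤ sSup (u '' Set.Icc 1 N) :=
  le_csSup ((Set.finite_Icc 1 N).image u).bddAbove ⟨t, ⟨h1, h2⟩, rfl⟩

variable {r} in
lemma Dominated.nonneg {σ : Penalty E I V} (hσ : r.Dominated σ) :
    (∀ i, 0 ≤ σ.h i) ∧ (∀ i, 0 ≤ σ.g i) ∧ ∀ i, 0 ≤ σ.F i := by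
  refine ⟨fun i => le_trans ?_ (hσ.1 i), fun i => le_trans ?_ (hσ.2.1 i),
    fun i => le_trans ?_ (hσ.2.2 i)⟩ <;>
  · refine Real.sSup_nonneg ?_
    rintro _ ⟨t, -, rfl⟩
    simp

end Path

variable {n : ℕ} {E I V : Type*} [Fintype E] [Fintype I] [Fintype V]
  {r : Pass n E I V} {q : AuxData n E I V} {ρ : ℝ}

lemma IsPass.δ_le (hr : r.IsPass q ρ) (hex : r.ExitsLoop q ρ) {t : ℕ} (h1 : 1 ≤ t)
    (h2 : t ≤ r.N) : r.δ t ≤ r.δ (t - 1) := by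
  rcases h2.eq_or_lt with rfl | h
  · exact hex.1
  · exact hr.no_restart t h1 h

lemma IsPass.feasible_pred (hr : r.IsPass q ρ) {t : ℕ} (h1 : 1 ≤ t) (h2 : t ≤ r.N) :
    q.IsFeasible (r.V1 t) (r.pt (t - 1)) := by
  obtain ⟨t, rfl⟩ := Nat.exists_eq_add_of_le' h1
  rw [Nat.add_sub_cancel]
  rcases Nat.eq_zero_or_pos t with rfl | ht
  · have e : r.pt 0 = (0, 1) := Prod.ext hr.s_zero hr.δ_zero
    rw [zero_add, hr.V1_one, e]
    exact q.isFeasible_zero_one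
  · obtain ⟨j, hj, -⟩ := hr.next_piece t ht h2
    rw [hj]
    exact (hr.solution t ht (by omega)).1.of_between (q.I1_subset_testPieces _ _ _)
      (q.testPieces_subset _ _ _)

/-- Consecutive points differ and each is the unique solution of a piece that contains its
predecessor, so the objective strictly decreases, no piece is visited twice, and the number of
pieces is bounded by the number of index sets. -/
lemma IsPass.N_le (hr : r.IsPass q ρ) (hB : q.B.PosDef) (hρ : 0 < ρ) {c : ℝ}
    (hc0 : 0 < c) (hc : ∀ s : Vec n, c * ‖s‖ ^ 2 ≤ inner ℝ s (q.opB s)) :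
    r.N ≤ Nat.card (Set V) := by
  -- the current point is feasible for the next piece, whose unique solution differs from it
  have step : ∀ t, 1 ≤ t → t < r.N → q.objective ρ (r.pt (t + 1)) < q.objective ρ (r.pt t) := by
    intro t h1 h2
    obtain ⟨j, -, hne, -⟩ := hr.next_piece t h1 h2
    exact (hr.multiplier (t + 1) (by omega) h2).objective_lt hB hρ hc0 hc
      (hr.solution (t + 1) (by omega) h2).1 (hr.feasible_pred (by omega) h2) hne.symm
  have lt : ∀ t t', 1 ≤ t → t < t' → t' ≤ r.N →
      q.objective ρ (r.pt t') < q.objective ρ (r.pt t) := by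
    intro t t' h1 h2
    induction t', h2 using Nat.le_induction with
    | base => exact step t h1
    | succ t' h ih =>
      intro h3
      exact (step t' (by omega) (by omega)).trans (ih (by omega))
  have ne : ∀ t t', 1 ≤ t → t < t' → t' ≤ r.N → r.V1 t ≠ r.V1 t' := by
    intro t t' h1 h2 h3 he
    have hs := (hr.solution t h1 (by omega)).2 (r.pt t') (he ▸ (hr.solution t' (by omega) h3).1)
    exact (lt t t' h1 h2 h3).not_ge hs
  have inj : Function.Injective fun t : Fin r.N => r.V1 (t + 1) := by
    intro t t' he
    rcases lt_trichotomy t t' with h | h | h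
    · exact absurd he (ne _ _ (by omega) (by simpa using h) (by omega))
    · exact h
    · exact absurd he.symm (ne _ _ (by omega) (by simpa using h) (by omega))
  simpa using Nat.card_le_card_of_injective _ inj

lemma IsPass.penModel_le (hr : r.IsPass q ρ) (hex : r.ExitsLoop q ρ) (hB : q.B.PosDef) {c : ℝ}
    (hc : ∀ s : Vec n, c * ‖s‖ ^ 2 ≤ inner ℝ s (q.opB s)) {σ : Penalty E I V}
    (hσ : r.Dominated σ) {t : ℕ} (h2 : t ≤ r.N) :
    q.penModel σ (r.pt t) ≤ q.infeas σ
      - c / 2 * ∑ τ ∈ Finset.Icc 1 t, ‖r.s τ - r.s (τ - 1)‖ ^ 2 := by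
  induction t with
  | zero => simp [AuxData.penModel, pt, hr.s_zero, hr.δ_zero]
  | succ t ih =>
    have h1 : 1 ≤ t + 1 := by omega
    have h := (hr.multiplier (t + 1) h1 h2).penModel_le (σ := σ) hB hc
      (hr.solution (t + 1) h1 h2).1 (hr.feasible_pred h1 h2) (hr.δ_le hex h1 h2)
      (fun i => (le_sSup_image_Icc (fun t => |(r.lam t).h i|) h1 h2).trans (hσ.1 i))
      (fun i => (le_sSup_image_Icc (fun t => |(r.lam t).g i|) h1 h2).trans (hσ.2.1 i))
      (fun i => (le_sSup_image_Icc (fun t => max |(r.lam t).H i| |(r.lam t).G i|) h1 h2).trans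
        (hσ.2.2 i))
    have ih := ih (by omega)
    rw [Finset.sum_Icc_succ_top h1, mul_add]
    simp only [pt, Nat.add_sub_cancel] at h ih ⊢
    linarith

/-- The line search model `Z` decreases at least by a multiple of the energy. -/
lemma IsPass.lineZ_le (hr : r.IsPass q ρ) (hex : r.ExitsLoop q ρ) (hB : q.B.PosDef) {c : ℝ}
    (hc : ∀ s : Vec n, c * ‖s‖ ^ 2 ≤ inner ℝ s (q.opB s)) {σ : Penalty E I V}
    (hσ : r.Dominated σ) (fx : ℝ) {γ : ℝ} (hS : 0 < r.len r.N) (h0 : 0 ≤ γ) (h1 : γ ≤ 1) :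
    lineZ q fx σ r γ ≤ fx + q.infeas σ - c / 2 * r.energy γ := by
  obtain ⟨a1, a2, a3, a4, -⟩ := r.seg_spec hr.one_le hS h0 h1
  obtain ⟨p1, p2, p3⟩ := hσ.nonneg
  have e1 := (hr.feasible_pred a1 a2).modelMerit_le p1 p2 p3 fx
  have e2 := (hr.solution _ a1 a2).1.modelMerit_le p1 p2 p3 fx
  have e3 := hr.penModel_le hex hB hc hσ ((Nat.sub_le _ 1).trans a2)
  have e4 := hr.penModel_le hex hB hc hσ a2
  have e5 : ∑ τ ∈ Finset.Icc 1 (r.seg γ), ‖r.s τ - r.s (τ - 1)‖ ^ 2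
      = ∑ τ ∈ Finset.Icc 1 (r.seg γ - 1), ‖r.s τ - r.s (τ - 1)‖ ^ 2
        + ‖r.s (r.seg γ) - r.s (r.seg γ - 1)‖ ^ 2 := by
    obtain ⟨t, ht⟩ := Nat.exists_eq_add_of_le' a1
    rw [ht, Finset.sum_Icc_succ_top (by omega), Nat.add_sub_cancel]
  have f0 : r.onSeg (r.seg γ) 0 = (r.pt (r.seg γ - 1)).1 := by simp [onSeg, pt]
  have f1 : r.onSeg (r.seg γ) 1 = (r.pt (r.seg γ)).1 := by simp [onSeg, pt]
  unfold lineZ energy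
  rw [f0, f1]
  rw [e5] at e4
  have g1 := mul_le_mul_of_nonneg_left (e1.trans (add_le_add_right e3 fx)) (sub_nonneg.2 a4)
  have g2 := mul_le_mul_of_nonneg_left (e2.trans (add_le_add_right e4 fx)) a3
  linarith

end Pass

/-! ### Uniform linearization of the merit function -/

section Taylor

variable {n : ℕ}

lemma inner_gradient (φ : Vec n → ℝ) (x s : Vec n) :
    inner ℝ (gradient φ x) s = fderiv ℝ φ x s := by
  rw [gradient, InnerProductSpace.toDual_symm_apply]

lemma continuous_gradient {φ : Vec n → ℝ} (hφ : ContDiff ℝ 1 φ) : Continuous (gradient φ) :=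
  (LinearIsometryEquiv.continuous _).comp (hφ.continuous_fderiv one_ne_zero)

/-- First-order Taylor expansion, uniform on bounded sets. -/
lemma eventually_taylor {φ : Vec n → ℝ} (hφ : ContDiff ℝ 1 φ) (R : ℝ) {ε : ℝ} (hε : 0 < ε) :
    ∀ᶠ η in 𝓝[>] (0 : ℝ), ∀ x s : Vec n, ‖x‖ ≤ R → ‖s‖ ≤ η →
      |φ (x + s) - φ x - inner ℝ (gradient φ x) s| ≤ ε * ‖s‖ := by
  have huc := (isCompact_closedBall (0 : Vec n) (R + 1)).uniformContinuousOn_of_continuous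
    (hφ.continuous_fderiv one_ne_zero).continuousOn
  obtain ⟨η, hη, h⟩ := Metric.uniformContinuousOn_iff.1 huc ε hε
  filter_upwards [Ioo_mem_nhdsGT (lt_min hη one_pos)] with e he x s hx hs
  have he1 : e < η := he.2.trans_le (min_le_left _ _)
  have he2 : e < 1 := he.2.trans_le (min_le_right _ _)
  have bound : ∀ y ∈ Metric.closedBall x e, ‖fderiv ℝ φ y - fderiv ℝ φ x‖ ≤ ε := by
    intro y hy
    rw [mem_closedBall_iff_norm] at hy
    have hy' : ‖y‖ ≤ R + 1 := by
      have := norm_le_norm_add_norm_sub' y x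
      linarith
    have := h y (by simpa using hy') x (by simp; linarith) (by rw [dist_eq_norm]; linarith)
    rw [dist_eq_norm] at this
    exact this.le
  have := (convex_closedBall x e).norm_image_sub_le_of_norm_fderiv_le'
    (fun y _ => (hφ.differentiable one_ne_zero) y) bound
    (Metric.mem_closedBall_self he.1.le) (y := x + s) (by simpa using hs)
  rwa [add_sub_cancel_left, Real.norm_eq_abs, ← inner_gradient] at this

/-- Bound on the linearization error of all problem functions at `x` for the displacement `s`. -/
def MPVC.TaylorBound {E I V : Type*} (P : MPVC n E I V) (x s : Vec n) (e : ℝ) : Prop :=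
  |P.f (x + s) - P.f x - inner ℝ (gradient P.f x) s| ≤ e ∧
  (∀ i, |P.h i (x + s) - P.h i x - inner ℝ (gradient (P.h i) x) s| ≤ e) ∧
  (∀ i, |P.g i (x + s) - P.g i x - inner ℝ (gradient (P.g i) x) s| ≤ e) ∧
  (∀ i, |P.G i (x + s) - P.G i x - inner ℝ (gradient (P.G i) x) s| ≤ e) ∧
  (∀ i, |P.H i (x + s) - P.H i x - inner ℝ (gradient (P.H i) x) s| ≤ e)

lemma MPVC.exists_taylorBound {E I V : Type*} [Finite E] [Finite I] [Finite V]
    (P : MPVC n E I V) (R : ℝ) {ε : ℝ} (hε : 0 < ε) :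
    ∃ η > 0, ∀ x s : Vec n, ‖x‖ ≤ R → ‖s‖ ≤ η → P.TaylorBound x s (ε * ‖s‖) := by
  have h := (eventually_taylor P.contDiff_f R hε).and <|
    (eventually_all.2 fun i => eventually_taylor (P.contDiff_h i) R hε).and <|
    (eventually_all.2 fun i => eventually_taylor (P.contDiff_g i) R hε).and <|
    (eventually_all.2 fun i => eventually_taylor (P.contDiff_G i) R hε).and <|
    (eventually_all.2 fun i => eventually_taylor (P.contDiff_H i) R hε)
  obtain ⟨η, ⟨h1, h2, h3, h4, h5⟩, hη⟩ := (h.and self_mem_nhdsWithin).exists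
  exact ⟨η, hη, fun x s hx hs => ⟨h1 x s hx hs, fun i => h2 i x s hx hs, fun i => h3 i x s hx hs,
    fun i => h4 i x s hx hs, fun i => h5 i x s hx hs⟩⟩

end Taylor

section Merit

variable {n : ℕ} {E I V : Type*} [Fintype E] [Fintype I] [Fintype V]

/-- The exact merit function of the program: the vanishing constraints are penalized by the distance
to the whole set `setP`, not to a convex piece of it. -/
noncomputable def MPVC.exactMerit (P : MPVC n E I V) (σ : Penalty E I V) (x : Vec n) : ℝ :=
  P.f x + ∑ i, σ.h i * |P.h i x| + ∑ i, σ.g i * max 0 (P.g i x)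
    + ∑ i, σ.F i * dist1 (-P.H i x, P.G i x) setP

lemma MPVC.continuous_exactMerit (P : MPVC n E I V) (σ : Penalty E I V) :
    Continuous (P.exactMerit σ) := by
  have h1 := P.contDiff_f.continuous
  have h2 := fun i => (P.contDiff_h i).continuous
  have h3 := fun i => (P.contDiff_g i).continuous
  have h4 := fun i => (P.contDiff_G i).continuous
  have h5 := fun i => (P.contDiff_H i).continuous
  have h6 := fun i => continuous_dist1_setP.comp ((h5 i).neg.prodMk (h4 i))
  unfold MPVC.exactMerit
  simp only [Function.comp_def] at h6
  fun_prop

lemma MPVC.add_infeas_auxData (P : MPVC n E I V) (σ : Penalty E I V)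
    (B : Matrix (Fin n) (Fin n) ℝ) (x : Vec n) :
    P.f x + (P.auxData B x).infeas σ = P.exactMerit σ x := by
  simp only [AuxData.infeas, MPVC.exactMerit, MPVC.auxData, AuxData.F]
  ring

lemma MPVC.exactMerit_le_merit (P : MPVC n E I V) {σ : Penalty E I V} (hF : ∀ i, 0 ≤ σ.F i)
    (V1 : Set V) (x s : Vec n) : P.exactMerit σ (x + s) ≤ merit P σ V1 x s := by
  classical
  unfold MPVC.exactMerit merit
  gcongr with i
  · exact hF i
  · exact dist1_anti _ (piece_nonempty _) (piece_subset _)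

lemma merit_zero (P : MPVC n E I V) (σ : Penalty E I V) (V1 : Set V)
    (B : Matrix (Fin n) (Fin n) ℝ) (x : Vec n) :
    merit P σ V1 x 0 = modelMerit (P.auxData B x) (P.f x) σ V1 0 := by
  simp [merit, modelMerit, MPVC.auxData, AuxData.F, AuxData.dF]

lemma AuxData.infeas_le_modelMerit_zero (q : AuxData n E I V) {σ : Penalty E I V}
    (hF : ∀ i, 0 ≤ σ.F i) (fx : ℝ) (V1 : Set V) :
    fx + q.infeas σ ≤ modelMerit q fx σ V1 0 := by
  classical
  have h : ∑ i, σ.F i * dist1 (q.F i) setP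
      ≤ ∑ i, σ.F i * dist1 (q.F i + q.dF i 0)
        (if i ∈ V1 then setP1 else setP2) := by
    refine Finset.sum_le_sum fun i _ => mul_le_mul_of_nonneg_left ?_ (hF i)
    have e : q.F i + q.dF i 0 = q.F i := by simp [AuxData.dF]
    rw [e]
    exact dist1_anti _ (piece_nonempty _) (piece_subset _)
  simp only [modelMerit, AuxData.infeas, inner_zero_left, inner_zero_right, add_zero, mul_zero]
  linarith

/-- The total weight of an error that affects all problem functions alike in the merit function. -/
def Penalty.weight (σ : Penalty E I V) : ℝ := 1 + ∑ i, σ.h i + ∑ i, σ.g i + 2 * ∑ i, σ.F i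

lemma merit_le_modelMerit (P : MPVC n E I V) {σ : Penalty E I V}
    (hh : ∀ i, 0 ≤ σ.h i) (hg : ∀ i, 0 ≤ σ.g i) (hF : ∀ i, 0 ≤ σ.F i) (V1 : Set V)
    (B : Matrix (Fin n) (Fin n) ℝ) {x s : Vec n} {e : ℝ} (he : P.TaylorBound x s e)
    (hB : 0 ≤ inner ℝ s ((P.auxData B x).opB s)) :
    merit P σ V1 x s ≤ modelMerit (P.auxData B x) (P.f x) σ V1 s + σ.weight * e := by
  classical
  obtain ⟨ef, eh, eg, eG, eH⟩ := he
  have hf := (le_abs_self _).trans ef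
  have h1 : ∑ i, σ.h i * |P.h i (x + s)|
      ≤ ∑ i, σ.h i * |P.h i x + inner ℝ (gradient (P.h i) x) s| + (∑ i, σ.h i) * e := by
    rw [Finset.sum_mul, ← Finset.sum_add_distrib]
    refine Finset.sum_le_sum fun i _ => ?_
    rw [← mul_add]
    refine mul_le_mul_of_nonneg_left ?_ (hh i)
    have := abs_sub_abs_le_abs_sub (P.h i (x + s)) (P.h i x + inner ℝ (gradient (P.h i) x) s)
    rw [← sub_sub] at this
    linarith [eh i]
  have h2 : ∑ i, σ.g i * max 0 (P.g i (x + s))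
      ≤ ∑ i, σ.g i * max 0 (P.g i x + inner ℝ (gradient (P.g i) x) s) + (∑ i, σ.g i) * e := by
    rw [Finset.sum_mul, ← Finset.sum_add_distrib]
    refine Finset.sum_le_sum fun i _ => ?_
    rw [← mul_add]
    refine mul_le_mul_of_nonneg_left ?_ (hg i)
    have h0 := (abs_nonneg _).trans (eg i)
    have := (le_abs_self _).trans (eg i)
    refine max_le (add_nonneg (le_max_left _ _) h0) ?_
    linarith [le_max_right 0 (P.g i x + inner ℝ (gradient (P.g i) x) s)]
  have h3 : ∑ i, σ.F i * dist1 (-P.H i (x + s), P.G i (x + s))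
        (if i ∈ V1 then setP1 else setP2)
      ≤ ∑ i, σ.F i * dist1 ((P.auxData B x).F i + (P.auxData B x).dF i s)
        (if i ∈ V1 then setP1 else setP2) + 2 * (∑ i, σ.F i) * e := by
    rw [mul_assoc, Finset.sum_mul, Finset.mul_sum, ← Finset.sum_add_distrib]
    refine Finset.sum_le_sum fun i _ => ?_
    rw [mul_left_comm, ← mul_add]
    refine mul_le_mul_of_nonneg_left ?_ (hF i)
    have e1 : ((-P.H i (x + s), P.G i (x + s)) : ℝ × ℝ)
        = ((P.auxData B x).F i + (P.auxData B x).dF i s)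
          + (-(P.H i (x + s) - P.H i x - inner ℝ (gradient (P.H i) x) s),
            P.G i (x + s) - P.G i x - inner ℝ (gradient (P.G i) x) s) := by
      ext <;> simp [AuxData.F, AuxData.dF, MPVC.auxData]
      ring
    rw [e1]
    refine (dist1_add_le _ _ (piece_nonempty _)).trans (add_le_add_right ?_ _)
    simp only [abs_neg]
    linarith [eG i, eH i]
  have e1 : inner ℝ (P.auxData B x).df s = inner ℝ (gradient P.f x) s := rfl
  unfold merit modelMerit Penalty.weight
  rw [e1]
  simp only [MPVC.auxData] at h3 ⊢
  simp only [MPVC.auxData] at hB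
  linarith

lemma modelMerit_convex (q : AuxData n E I V) {σ : Penalty E I V}
    (hh : ∀ i, 0 ≤ σ.h i) (hg : ∀ i, 0 ≤ σ.g i) (hF : ∀ i, 0 ≤ σ.F i) (fx : ℝ) (V1 : Set V)
    (hB : ∀ s : Vec n, 0 ≤ inner ℝ s (q.opB s)) (u v : Vec n) {α : ℝ} (h0 : 0 ≤ α) (h1 : α ≤ 1) :
    modelMerit q fx σ V1 ((1 - α) • u + α • v)
      ≤ (1 - α) * modelMerit q fx σ V1 u + α * modelMerit q fx σ V1 v := by
  classical
  have e1 : ∑ i, σ.h i * |q.h i + inner ℝ (q.dh i) ((1 - α) • u + α • v)|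
      ≤ (1 - α) * ∑ i, σ.h i * |q.h i + inner ℝ (q.dh i) u|
        + α * ∑ i, σ.h i * |q.h i + inner ℝ (q.dh i) v| := by
    rw [Finset.mul_sum, Finset.mul_sum, ← Finset.sum_add_distrib]
    refine Finset.sum_le_sum fun i _ => ?_
    have := mul_le_mul_of_nonneg_left (abs_convex (a := q.h i + inner ℝ (q.dh i) u)
      (b := q.h i + inner ℝ (q.dh i) v) h0 h1) (hh i)
    rw [inner_add_right, real_inner_smul_right, real_inner_smul_right]
    convert this using 1
    · congr 2; ring
    · ring
  have e2 : ∑ i, σ.g i * max 0 (q.g i + inner ℝ (q.dg i) ((1 - α) • u + α • v))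
      ≤ (1 - α) * ∑ i, σ.g i * max 0 (q.g i + inner ℝ (q.dg i) u)
        + α * ∑ i, σ.g i * max 0 (q.g i + inner ℝ (q.dg i) v) := by
    rw [Finset.mul_sum, Finset.mul_sum, ← Finset.sum_add_distrib]
    refine Finset.sum_le_sum fun i _ => ?_
    have := mul_le_mul_of_nonneg_left (max_zero_convex (a := q.g i + inner ℝ (q.dg i) u)
      (b := q.g i + inner ℝ (q.dg i) v) h0 h1) (hg i)
    rw [inner_add_right, real_inner_smul_right, real_inner_smul_right]
    convert this using 1
    · congr 2; ring
    · ring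
  have e3 : ∑ i, σ.F i * dist1 (q.F i + q.dF i ((1 - α) • u + α • v))
        (if i ∈ V1 then setP1 else setP2)
      ≤ (1 - α) * ∑ i, σ.F i * dist1 (q.F i + q.dF i u)
          (if i ∈ V1 then setP1 else setP2)
        + α * ∑ i, σ.F i * dist1 (q.F i + q.dF i v)
          (if i ∈ V1 then setP1 else setP2) := by
    rw [Finset.mul_sum, Finset.mul_sum, ← Finset.sum_add_distrib]
    refine Finset.sum_le_sum fun i _ => ?_
    have e : q.F i + q.dF i ((1 - α) • u + α • v)
        = (1 - α) • (q.F i + q.dF i u) + α • (q.F i + q.dF i v) := by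
      ext <;> simp [AuxData.dF, inner_add_right, real_inner_smul_right] <;> ring
    have := mul_le_mul_of_nonneg_left (dist1_piece_convex (i ∈ V1)
      (q.F i + q.dF i u) (q.F i + q.dF i v) h0 h1) (hF i)
    rw [e]
    linarith
  have e4 : inner ℝ ((1 - α) • u + α • v) (q.opB ((1 - α) • u + α • v))
      = (1 - α) * inner ℝ u (q.opB u) + α * inner ℝ v (q.opB v)
        - α * (1 - α) * inner ℝ (u - v) (q.opB (u - v)) := by
    simp only [map_add, map_sub, map_smul, inner_add_left, inner_add_right, inner_sub_left,
      inner_sub_right, real_inner_smul_left, real_inner_smul_right]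
    ring
  have e5 : 0 ≤ α * (1 - α) * inner ℝ (u - v) (q.opB (u - v)) :=
    mul_nonneg (mul_nonneg h0 (by linarith)) (hB _)
  unfold modelMerit
  rw [e4, inner_add_right q.df, real_inner_smul_right, real_inner_smul_right]
  linarith

/-! ### The line search -/

variable {r : Pass n E I V} {P : MPVC n E I V} {B : Matrix (Fin n) (Fin n) ℝ} {x : Vec n} {ρ : ℝ}

/-- The model interpolated along the segments overestimates the merit function up to the
linearization error, because the model of each piece is convex. -/
lemma lineY_le_lineZ {σ : Penalty E I V} (hσ : r.Dominated σ)
    (hB : ∀ s : Vec n, 0 ≤ inner ℝ s ((P.auxData B x).opB s)) {γ e : ℝ} (hpos0 : 0 ≤ r.pos γ)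
    (hpos1 : r.pos γ ≤ 1) (he : P.TaylorBound x (r.curve γ) e) :
    lineY P σ x r γ ≤ lineZ (P.auxData B x) (P.f x) σ r γ + σ.weight * e := by
  obtain ⟨p1, p2, p3⟩ := hσ.nonneg
  refine (merit_le_modelMerit P p1 p2 p3 _ B he (hB _)).trans (add_le_add_left ?_ _)
  have := modelMerit_convex (P.auxData B x) p1 p2 p3 (P.f x) (r.V1 (r.seg γ)) hB
    (r.s (r.seg γ - 1)) (r.s (r.seg γ)) hpos0 hpos1
  simpa [lineZ, Pass.curve, Pass.onSeg] using this

/-- At `γ = 0` the merit function of the current piece, its model, and the exact merit function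
agree. -/
lemma line_zero {σ : Penalty E I V} (hσ : r.Dominated σ) (hr : r.IsPass (P.auxData B x) ρ)
    (hex : r.ExitsLoop (P.auxData B x) ρ) (hBp : B.PosDef) {c : ℝ} (hc0 : 0 < c)
    (hc : ∀ s : Vec n, c * ‖s‖ ^ 2 ≤ inner ℝ s ((P.auxData B x).opB s)) (hS : 0 < r.len r.N) :
    lineZ (P.auxData B x) (P.f x) σ r 0 = P.exactMerit σ x ∧
      lineY P σ x r 0 = P.exactMerit σ x := by
  obtain ⟨h1, h2⟩ := r.pos_zero hS
  -- leading segments of length zero are skipped by `seg`, but the path still starts at `0`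
  have h3 : r.s (r.seg 0 - 1) = 0 :=
    norm_le_zero_iff.1 ((r.norm_s_le_len hr.s_zero _).trans_eq h2)
  have hZ : lineZ (P.auxData B x) (P.f x) σ r 0
      = modelMerit (P.auxData B x) (P.f x) σ (r.V1 (r.seg 0)) 0 := by
    simp [lineZ, h1, Pass.onSeg, h3]
  have hY : lineY P σ x r 0 = lineZ (P.auxData B x) (P.f x) σ r 0 := by
    rw [hZ, ← merit_zero]
    simp [lineY, Pass.curve, Pass.onSeg, h1, h3]
  -- the piece of the first proper segment may differ from the initial one; its model at `0` is bounded
  -- above by the penalized model and below by the exact merit function, and both have the same value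
  have h4 := hr.lineZ_le hex hBp hc hσ (P.f x) hS le_rfl zero_le_one
  have h5 := r.energy_nonneg hr.one_le hS le_rfl zero_le_one
  have h6 := (P.auxData B x).infeas_le_modelMerit_zero hσ.nonneg.2.2 (P.f x) (r.V1 (r.seg 0))
  rw [← hZ] at h6
  have h7 : 0 ≤ c / 2 * r.energy 0 := by positivity
  have h8 := P.add_infeas_auxData σ B x
  have h9 : lineZ (P.auxData B x) (P.f x) σ r 0 = P.exactMerit σ x := by linarith
  exact ⟨h9, hY.trans h9⟩

end Merit

namespace Iterates

/-! ### The penalty parameters -/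

lemma le_penaltyUpdate (p : Params) {σ l : ℝ} (hl : 0 ≤ l) : l ≤ penaltyUpdate p σ l := by
  have h1 := p.one_lt_ξ₁
  have h2 := p.ξ₁_lt_ξ₂
  unfold penaltyUpdate
  split_ifs with h
  · exact le_mul_of_one_le_left hl (by linarith)
  · exact (le_mul_of_one_le_left hl h1.le).trans (not_lt.1 h)

/-- Every proper update multiplies the penalty by more than `ξ₂ / ξ₁ > 1`, so a bounded multiplier
estimate allows only finitely many of them. -/
lemma exists_forall_ge_penalty_eq (p : Params) {u l : ℕ → ℝ} {C : ℝ} (h0 : 0 < u 0)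
    (hl : ∀ k, 0 ≤ l k) (hC : ∀ k, l k ≤ C) (hu : ∀ k, u (k + 1) = penaltyUpdate p (u k) (l k)) :
    ∃ k₀, ∀ k ≥ k₀, u k = u k₀ := by
  have h1 := p.one_lt_ξ₁
  have h2 := p.ξ₁_lt_ξ₂
  have hcase : ∀ k, u (k + 1) = u k ∨ (u k < p.ξ₁ * l k ∧ u (k + 1) = p.ξ₂ * l k) := by
    intro k
    rw [hu k]
    unfold penaltyUpdate
    split_ifs with h
    · exact Or.inr ⟨h, rfl⟩
    · exact Or.inl rfl
  have hmono : Monotone u := monotone_nat_of_le_succ fun k => by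
    rcases hcase k with h | ⟨h, h'⟩
    · exact h.ge
    · rw [h']
      exact h.le.trans (mul_le_mul_of_nonneg_right h2.le (hl k))
  have hbdd : ∀ k, u k ≤ max (u 0) (p.ξ₂ * C) := by
    intro k
    induction k with
    | zero => exact le_max_left _ _
    | succ k ih =>
      rcases hcase k with h | ⟨-, h⟩
      · rwa [h]
      · rw [h]
        exact (mul_le_mul_of_nonneg_left (hC k) (by linarith)).trans (le_max_right _ _)
  have hb : BddAbove (Set.range u) := ⟨_, by rintro _ ⟨k, rfl⟩; exact hbdd k⟩
  have ht := tendsto_atTop_ciSup hmono hb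
  have hL : ∀ k, u k ≤ ⨆ k, u k := le_ciSup hb
  have hL0 : 0 < ⨆ k, u k := h0.trans_le (hL 0)
  have hlt : p.ξ₁ / p.ξ₂ * (⨆ k, u k) < ⨆ k, u k :=
    mul_lt_of_lt_one_left hL0 ((div_lt_one (by linarith)).2 h2)
  obtain ⟨k₀, hk₀⟩ := eventually_atTop.1 (ht.eventually (lt_mem_nhds hlt))
  refine ⟨k₀, fun k hk => ?_⟩
  induction k, hk using Nat.le_induction with
  | base => rfl
  | succ k hk ih =>
    rcases hcase k with h | ⟨h, h'⟩
    · exact h.trans ih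
    · exfalso
      have h3 := (hk₀ k hk).trans h
      have h4 := hL (k + 1)
      rw [h'] at h4
      rw [div_mul_eq_mul_div, div_lt_iff₀ (by linarith)] at h3
      nlinarith

variable {n : ℕ} {E I V : Type*} [Fintype E] [Fintype I] [Fintype V]
  {a : Iterates n E I V} {P : MPVC n E I V} {p : Params}

lemma IsGenerated.exists_forall_ge_σ_eq (hgen : a.IsGenerated P p) (hbdd : a.IsBounded) :
    ∃ k₀, ∀ k ≥ k₀, a.σ k = a.σ k₀ := by
  obtain ⟨C, hC⟩ := hbdd.lam_bdd
  have e1 : ∀ i, ∃ k₀, ∀ k ≥ k₀, (a.σ k).h i = (a.σ k₀).h i := fun i =>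
    exists_forall_ge_penalty_eq p (hgen.σ_init_pos.1 i)
      (fun k => Real.sSup_nonneg (by rintro _ ⟨t, -, rfl⟩; positivity)) (fun k => (hC k).1 i)
      fun k => hgen.penalty_h k i
  have e2 : ∀ i, ∃ k₀, ∀ k ≥ k₀, (a.σ k).g i = (a.σ k₀).g i := fun i =>
    exists_forall_ge_penalty_eq p (hgen.σ_init_pos.2.1 i)
      (fun k => Real.sSup_nonneg (by rintro _ ⟨t, -, rfl⟩; positivity)) (fun k => (hC k).2.1 i)
      fun k => hgen.penalty_g k i
  have e3 : ∀ i, ∃ k₀, ∀ k ≥ k₀, (a.σ k).F i = (a.σ k₀).F i := fun i =>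
    exists_forall_ge_penalty_eq p (hgen.σ_init_pos.2.2 i)
      (fun k => Real.sSup_nonneg (by rintro _ ⟨t, -, rfl⟩; positivity)) (fun k => (hC k).2.2 i)
      fun k => hgen.penalty_F k i
  choose k1 h1 using e1
  choose k2 h2 using e2
  choose k3 h3 using e3
  have f1 : ∀ᶠ k in atTop, ∀ i, k1 i ≤ k := eventually_all.2 fun i => eventually_ge_atTop _
  have f2 : ∀ᶠ k in atTop, ∀ i, k2 i ≤ k := eventually_all.2 fun i => eventually_ge_atTop _
  have f3 : ∀ᶠ k in atTop, ∀ i, k3 i ≤ k := eventually_all.2 fun i => eventually_ge_atTop _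
  obtain ⟨k₀, g1, g2, g3⟩ := (f1.and (f2.and f3)).exists
  have ext : ∀ σ τ : Penalty E I V, σ.h = τ.h → σ.g = τ.g → σ.F = τ.F → σ = τ := by
    rintro ⟨⟩ ⟨⟩ rfl rfl rfl; rfl
  refine ⟨k₀, fun k hk => ext _ _ (funext fun i => ?_) (funext fun i => ?_) (funext fun i => ?_)⟩
  · rw [h1 i k ((g1 i).trans hk), h1 i k₀ (g1 i)]
  · rw [h2 i k ((g2 i).trans hk), h2 i k₀ (g2 i)]
  · rw [h3 i k ((g3 i).trans hk), h3 i k₀ (g3 i)]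

lemma IsGenerated.dominated (hgen : a.IsGenerated P p) (k : ℕ) :
    (a.pass k).Dominated (a.σ (k + 1)) := by
  refine ⟨fun i => ?_, fun i => ?_, fun i => ?_⟩
  · rw [hgen.penalty_h]
    exact le_penaltyUpdate p (Real.sSup_nonneg (by rintro _ ⟨t, -, rfl⟩; positivity))
  · rw [hgen.penalty_g]
    exact le_penaltyUpdate p (Real.sSup_nonneg (by rintro _ ⟨t, -, rfl⟩; positivity))
  · rw [hgen.penalty_F]
    exact le_penaltyUpdate p (Real.sSup_nonneg (by rintro _ ⟨t, -, rfl⟩; positivity))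

lemma IsGenerated.ρ_pos (hgen : a.IsGenerated P p) (k : ℕ) : 0 < a.ρ k := by
  induction k with
  | zero => exact hgen.ρ_zero_pos
  | succ k ih =>
    obtain ⟨m, h, -⟩ := hgen.solver k
    rw [h]
    exact mul_pos ih (pow_pos (zero_lt_one.trans p.one_lt_ρbar) m)

lemma IsGenerated.isPass (hgen : a.IsGenerated P p) (k : ℕ) :
    (a.pass k).IsPass (a.aux P k) (a.ρ (k + 1)) := by
  obtain ⟨m, -, -, h, -⟩ := hgen.solver k
  exact h

lemma IsGenerated.succeeds (hgen : a.IsGenerated P p) (k : ℕ) :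
    (a.pass k).Succeeds (a.aux P k) (a.ρ (k + 1)) p.ζ := by
  obtain ⟨m, -, -, -, h⟩ := hgen.solver k
  exact h

lemma IsGenerated.len_pos (hgen : a.IsGenerated P p) (k : ℕ) :
    0 < (a.pass k).len (a.pass k).N :=
  (norm_pos_iff.2 (hgen.not_stopped k)).trans_le
    ((a.pass k).norm_s_le_len (hgen.isPass k).s_zero _)

/-! ### Step lengths -/

lemma IsGenerated.γ_antitone (hgen : a.IsGenerated P p) (k : ℕ) : Antitone (a.γ k) :=
  antitone_nat_of_succ_le fun j => by
    have h := (div_le_iff₀ (hgen.γ_pos k j)).1 (hgen.γ_ratio k j).2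
    exact h.trans (mul_le_of_le_one_left (hgen.γ_pos k j).le p.γhi_lt.le)

lemma IsGenerated.γ_le_one (hgen : a.IsGenerated P p) (k j : ℕ) : a.γ k j ≤ 1 :=
  (hgen.γ_antitone k j.zero_le).trans_eq (hgen.γ_zero k)

/-- The trial parameters hit every interval `[γlo γ', γ']` with `γ' < 1`. -/
lemma IsGenerated.exists_γ_mem (hgen : a.IsGenerated P p) (k : ℕ) {γ' : ℝ} (h0 : 0 < γ')
    (h1 : γ' < 1) : ∃ j, p.γlo * γ' ≤ a.γ k j ∧ a.γ k j ≤ γ' := by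
  have hpow : ∀ j, a.γ k j ≤ p.γhi ^ j := by
    intro j
    induction j with
    | zero => simp [hgen.γ_zero k]
    | succ j ih =>
      have h := (div_le_iff₀ (hgen.γ_pos k j)).1 (hgen.γ_ratio k j).2
      rw [pow_succ']
      exact h.trans (mul_le_mul_of_nonneg_left ih (p.γlo_pos.le.trans p.γlo_le))
  obtain ⟨m, hm⟩ := exists_pow_lt_of_lt_one h0 p.γhi_lt
  have hex : ∃ j, a.γ k j ≤ γ' := ⟨m, (hpow m).trans hm.le⟩
  classical
  refine ⟨Nat.find hex, ?_, Nat.find_spec hex⟩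
  have hne : Nat.find hex ≠ 0 := by
    intro h
    have := Nat.find_spec hex
    rw [h, hgen.γ_zero k] at this
    linarith
  obtain ⟨i, hi⟩ := Nat.exists_eq_succ_of_ne_zero hne
  have h2 : γ' < a.γ k i := not_le.1 (Nat.find_min hex (by omega))
  rw [hi]
  have h := (le_div_iff₀ (hgen.γ_pos k i)).1 (hgen.γ_ratio k i).1
  exact (mul_le_mul_of_nonneg_left h2.le p.γlo_pos.le).trans h

/-- The matrices `B k` are uniformly elliptic with constant `c`. -/
def Elliptic (a : Iterates n E I V) (P : MPVC n E I V) (c : ℝ) : Prop :=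
  ∀ k, ∀ s : Vec n, c * ‖s‖ ^ 2 ≤ inner ℝ s ((a.aux P k).opB s)

/-- If the polygonal line of iteration `k` reaches length `β` within `t` segments, the accepted step
has an energy that is bounded below independently of `k`. By induction on `t`, the first `t - 1`
segments may be assumed short in comparison with the last one. The model then decreases linearly
along the last segment, and this dominates the linearization error for all small steps that go
beyond the short initial part. -/
lemma IsGenerated.exists_energy_ge (hgen : a.IsGenerated P p) {c R L W : ℝ} (hc0 : 0 < c)
    (hc : a.Elliptic P c) (hR : ∀ k, ‖a.x k‖ ≤ R) (hL : ∀ k, (a.pass k).len (a.pass k).N ≤ L)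
    {k₀ : ℕ} (hW : ∀ k ≥ k₀, (a.σ (k + 1)).weight ≤ W) (t : ℕ) :
    ∀ β > 0, ∃ κ > 0, ∀ k ≥ k₀, t ≤ (a.pass k).N → β ≤ (a.pass k).len t →
      κ ≤ (a.pass k).energy (a.γ k (a.j k)) := by
  induction t with
  | zero =>
    intro β hβ
    refine ⟨1, one_pos, fun k _ _ h => ?_⟩
    rw [Pass.len_zero] at h
    linarith
  | succ t ih =>
    intro β hβ
    have hξ := p.ξ_lt
    have hlo := p.γlo_pos
    have hlo1 : p.γlo < 1 := p.γlo_le.trans_lt p.γhi_lt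
    have hL0 : 0 < L := (hgen.len_pos 0).trans_le (hL 0)
    set W' := max W 1
    have hW' : 0 < W' := lt_max_of_lt_right one_pos
    -- `ε` is the slope of the guaranteed model decrease, times the slack factor `1 - ξ`.
    set ε := (1 - p.ξ) * c * β / 8 with hε
    have hε0 : 0 < ε := by
      have : 0 < 1 - p.ξ := by linarith
      positivity
    obtain ⟨η, hη, hT⟩ := P.exists_taylorBound R (div_pos hε0 hW')
    -- Below `γ'`, the step stays within the Taylor radius `η` and is shorter than half of `β`; the
    -- trial parameters hit `[γlo γ', γ']`, where the step is at least twice as long as `β'`.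
    set γ' := min (min η (β / 2) / L) (1 / 2) with hγ'
    have hγ'0 : 0 < γ' := lt_min (div_pos (lt_min hη (by linarith)) hL0) (by norm_num)
    have hγ'1 : γ' < 1 := (min_le_right _ _).trans_lt (by norm_num)
    set β' := p.γlo * γ' * β / 2 with hβ'
    have hβ'0 : 0 < β' := by positivity
    have hβ'β : β' ≤ β / 2 := by
      have : p.γlo * γ' ≤ 1 := mul_le_one₀ hlo1.le hγ'0.le hγ'1.le
      rw [hβ']
      have := mul_le_of_le_one_left hβ.le this
      linarith
    obtain ⟨κ, hκ, ih⟩ := ih β' hβ'0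
    refine ⟨min κ (β / 2 * β'), by positivity, fun k hk ht hlen => ?_⟩
    by_cases hshort : β' ≤ (a.pass k).len t
    · exact (min_le_left _ _).trans (ih k hk (by omega) hshort)
    refine (min_le_right _ _).trans ?_
    rw [not_le] at hshort
    have hr := hgen.isPass k
    have hex := (hgen.succeeds k).1
    have hS := hgen.len_pos k
    have hβS : β ≤ (a.pass k).len (a.pass k).N := hlen.trans ((a.pass k).len_mono ht)
    have hseg : β / 2 ≤ ‖(a.pass k).s (t + 1) - (a.pass k).s t‖ := by
      have := (a.pass k).len_pred_add (Nat.le_add_left 1 t)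
      rw [Nat.add_sub_cancel] at this
      linarith
    have hu : ∀ γ, p.γlo * γ' ≤ γ → 2 * β' ≤ γ * (a.pass k).len (a.pass k).N := by
      intro γ hγ
      calc 2 * β' = p.γlo * γ' * β := by rw [hβ']; ring
        _ ≤ γ * (a.pass k).len (a.pass k).N :=
          mul_le_mul hγ hβS hβ.le ((by positivity : 0 ≤ p.γlo * γ').trans hγ)
    obtain ⟨j, hj1, hj2⟩ := hgen.exists_γ_mem k hγ'0 hγ'1
    have hacc : a.Accepts P p k (a.γ k j) := by
      set γ := a.γ k j
      have hγ0 : 0 < γ := hgen.γ_pos k j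
      have hγ1 : γ ≤ 1 := hgen.γ_le_one k j
      have hu1 := hu γ hj1
      have hu2 : γ * (a.pass k).len (a.pass k).N ≤ min η (β / 2) := by
        calc γ * (a.pass k).len (a.pass k).N ≤ γ' * L := mul_le_mul hj2 (hL k) hS.le hγ'0.le
          _ ≤ min η (β / 2) / L * L := by gcongr; exact min_le_left _ _
          _ = min η (β / 2) := div_mul_cancel₀ _ hL0.ne'
      have hcurve := (a.pass k).norm_curve_le hr.one_le hr.s_zero hS hγ0.le hγ1
      have hen := (a.pass k).energy_ge hr.one_le hS hγ0.le hγ1 hseg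
        (m := γ * (a.pass k).len (a.pass k).N / 2) (by linarith)
        (by linarith [min_le_right η (β / 2)]) (by linarith)
      obtain ⟨-, -, s3, s4, -⟩ := (a.pass k).seg_spec hr.one_le hS hγ0.le hγ1
      have hdom := hgen.dominated k
      have hY := lineY_le_lineZ (B := a.B k) hdom
        (fun s => le_trans (by positivity) (hc k s)) s3 s4
        (hT (a.x k) _ (hR k) (hcurve.trans (hu2.trans (min_le_left _ _))))
      obtain ⟨hZ0, hY0⟩ := line_zero hdom hr hex (hgen.posDef k) hc0 (hc k) hS
      have hZ := hr.lineZ_le hex (hgen.posDef k) (hc k) hdom (P.f (a.x k)) hS hγ0.le hγ1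
      have herr : (a.σ (k + 1)).weight * (ε / W' * ‖(a.pass k).curve γ‖)
          ≤ ε * (γ * (a.pass k).len (a.pass k).N) := by
        calc (a.σ (k + 1)).weight * (ε / W' * ‖(a.pass k).curve γ‖)
            ≤ W' * (ε / W' * (γ * (a.pass k).len (a.pass k).N)) :=
              mul_le_mul ((hW k hk).trans (le_max_left _ _)) (by gcongr) (by positivity) hW'.le
          _ = ε * (γ * (a.pass k).len (a.pass k).N) := by field_simp
      have hadd := P.add_infeas_auxData (a.σ (k + 1)) (a.B k) (a.x k)
      unfold Accepts
      simp only [aux] at hZ ⊢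
      rw [hZ0, hY0]
      have h5 := mul_le_mul_of_nonneg_left hen (by positivity : 0 ≤ c / 2)
      have h6 : ε * (γ * (a.pass k).len (a.pass k).N)
          = (1 - p.ξ) * (c / 2 * (β / 2 * (γ * (a.pass k).len (a.pass k).N / 2))) := by
        rw [hε]; ring
      have h7 : lineZ (P.auxData (a.B k) (a.x k)) (P.f (a.x k)) (a.σ (k + 1)) (a.pass k) γ
          - P.exactMerit (a.σ (k + 1)) (a.x k)
          ≤ -(c / 2 * (β / 2 * (γ * (a.pass k).len (a.pass k).N / 2))) := by linarith
      have h8 := mul_le_mul_of_nonneg_left h7 (by linarith : 0 ≤ 1 - p.ξ)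
      linarith
    -- the accepted parameter is the first acceptable one, hence not smaller than this one
    have hle := hgen.γ_antitone k ((hgen.j_least k).2 hacc)
    have hγj := hj1.trans hle
    have := hu _ hγj
    exact (a.pass k).energy_ge hr.one_le hS (hgen.γ_pos k _).le (hgen.γ_le_one k _) hseg hβ'0 hβ'β
      (by linarith)

/-- Switching pieces between iterations does no harm: the merit function of any piece lies above the
exact one, and agrees with it at the beginning of the step. -/
lemma IsGenerated.exactMerit_succ_le (hgen : a.IsGenerated P p) {c : ℝ} (hc0 : 0 < c)
    (hc : a.Elliptic P c) (k : ℕ) :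
    P.exactMerit (a.σ (k + 1)) (a.x (k + 1)) ≤ P.exactMerit (a.σ (k + 1)) (a.x k)
      - p.ξ * (c / 2) * (a.pass k).energy (a.γ k (a.j k)) := by
  have hr := hgen.isPass k
  have hex := (hgen.succeeds k).1
  have hS := hgen.len_pos k
  have hdom := hgen.dominated k
  have hacc : a.Accepts P p k (a.γ k (a.j k)) := (hgen.j_least k).1
  obtain ⟨hZ0, hY0⟩ := line_zero hdom hr hex (hgen.posDef k) hc0 (hc k) hS
  have hZ := hr.lineZ_le hex (hgen.posDef k) (hc k) hdom (P.f (a.x k)) hS (hgen.γ_pos k _).le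
    (hgen.γ_le_one k (a.j k))
  have hadd := P.add_infeas_auxData (a.σ (k + 1)) (a.B k) (a.x k)
  have hY := P.exactMerit_le_merit hdom.nonneg.2.2
    ((a.pass k).V1 ((a.pass k).seg (a.γ k (a.j k)))) (a.x k)
    ((a.pass k).curve (a.γ k (a.j k)))
  rw [← hgen.step k] at hY
  unfold Accepts at hacc
  simp only [aux] at hacc hZ
  rw [hZ0, hY0, lineY] at hacc
  have h := mul_le_mul_of_nonneg_left (b := lineZ (P.auxData (a.B k) (a.x k)) (P.f (a.x k))
    (a.σ (k + 1)) (a.pass k) (a.γ k (a.j k)) - P.exactMerit (a.σ (k + 1)) (a.x k))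
    (c := -(c / 2 * (a.pass k).energy (a.γ k (a.j k)))) (by linarith) p.ξ_pos.le
  linarith

/-- The polygonal lines shrink to a point: the exact merit function with the final penalties
decreases by at least a multiple of the energies and is bounded below. -/
lemma IsGenerated.tendsto_len (hgen : a.IsGenerated P p) (hbdd : a.IsBounded) :
    Tendsto (fun k => (a.pass k).len (a.pass k).N) atTop (𝓝 0) := by
  obtain ⟨R, hR⟩ := hbdd.x_bdd
  obtain ⟨L, hL⟩ := hbdd.len_bdd
  obtain ⟨c, hc0, heig⟩ := hbdd.eig_lower
  have hc : a.Elliptic P c := fun k s => AuxData.inner_opB_ge (hgen.posDef k) (heig k) s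
  obtain ⟨k₀, hk₀⟩ := hgen.exists_forall_ge_σ_eq hbdd
  have hσ : ∀ k ≥ k₀, a.σ (k + 1) = a.σ k₀ := fun k hk => hk₀ (k + 1) (hk.trans k.le_succ)
  have hdec : ∀ k ≥ k₀, P.exactMerit (a.σ k₀) (a.x (k + 1)) ≤ P.exactMerit (a.σ k₀) (a.x k)
      - p.ξ * (c / 2) * (a.pass k).energy (a.γ k (a.j k)) := by
    intro k hk
    rw [← hσ k hk]
    exact hgen.exactMerit_succ_le hc0 hc k
  have hpos : 0 < p.ξ * (c / 2) := mul_pos p.ξ_pos (by linarith)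
  have hen0 : ∀ k, 0 ≤ (a.pass k).energy (a.γ k (a.j k)) := fun k =>
    (a.pass k).energy_nonneg (hgen.isPass k).one_le (hgen.len_pos k) (hgen.γ_pos k _).le
      (hgen.γ_le_one k _)
  have hen : Tendsto (fun k => (a.pass k).energy (a.γ k (a.j k))) atTop (𝓝 0) := by
    obtain ⟨b, hb⟩ := (isCompact_closedBall (0 : Vec n) R).bddBelow_image
      (P.continuous_exactMerit (a.σ k₀)).continuousOn
    set v : ℕ → ℝ := fun k => P.exactMerit (a.σ k₀) (a.x (k + k₀))
    have hanti : Antitone v := antitone_nat_of_succ_le fun k => by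
      have h1 := hdec (k + k₀) (Nat.le_add_left _ _)
      have h2 := mul_nonneg hpos.le (hen0 (k + k₀))
      simp only [v]
      rw [add_right_comm]
      linarith
    have hlim := tendsto_atTop_ciInf hanti ⟨b, by
      rintro _ ⟨k, rfl⟩
      exact hb ⟨_, by simpa using hR _, rfl⟩⟩
    have hdiff : Tendsto (fun k => (v k - v (k + 1)) / (p.ξ * (c / 2))) atTop (𝓝 0) := by
      have := (hlim.sub (hlim.comp (tendsto_add_atTop_nat 1))).div_const (p.ξ * (c / 2))
      simpa using this
    rw [← tendsto_add_atTop_iff_nat k₀]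
    refine squeeze_zero (fun k => hen0 _) (fun k => ?_) hdiff
    have h1 := hdec (k + k₀) (Nat.le_add_left _ _)
    rw [le_div_iff₀ hpos]
    simp only [v]
    rw [add_right_comm k 1 k₀]
    linarith
  have hW : ∀ k ≥ k₀, (a.σ (k + 1)).weight ≤ (a.σ k₀).weight := fun k hk => by rw [hσ k hk]
  refine tendsto_order.2 ⟨fun b hb => Eventually.of_forall fun k => hb.trans (hgen.len_pos k),
    fun β hβ => ?_⟩
  have key : ∀ t, ∃ κ > 0, ∀ k ≥ k₀, t ≤ (a.pass k).N → β ≤ (a.pass k).len t →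
      κ ≤ (a.pass k).energy (a.γ k (a.j k)) := fun t =>
    hgen.exists_energy_ge hc0 hc hR hL hW t β hβ
  choose κ hκ0 hκ using key
  have hev : ∀ᶠ k in atTop, ∀ t ∈ Finset.range (Nat.card (Set V) + 1),
      (a.pass k).energy (a.γ k (a.j k)) < κ t :=
    (eventually_all_finset _).2 fun t _ => hen.eventually (gt_mem_nhds (hκ0 t))
  filter_upwards [hev, eventually_ge_atTop k₀] with k h1 h2
  have hN := (hgen.isPass k).N_le (hgen.posDef k) (hgen.ρ_pos (k + 1)) hc0 (hc k)
  by_contra! h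
  exact (h1 (a.pass k).N (Finset.mem_range.2 (Nat.lt_succ_of_le hN))).not_ge
    (hκ _ k h2 le_rfl h)

end Iterates

/-! ### Passage to the limit -/

namespace AuxData

variable {n : ℕ} {E I V : Type*} [Fintype E] [Fintype I] [Fintype V]

/-- A multiplier of the piece `I¹ ∪ I⁰⁰` is M-stationary for the auxiliary problem: on `I⁰⁰` the
component `λ^G` vanishes, because `setP1` contains the whole line `{0} × ℝ`. -/
lemma IsKKT.complementarity {q : AuxData n E I V} {ρ : ℝ} {z : Vec n × ℝ} {l : Multiplier E I V}
    (hl : q.IsKKT ρ (q.I1 z ∪ q.I00 z) z l) (i : V) :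
    l.H i * (q.relaxedF z i).1 = 0 ∧ l.G i * (q.relaxedF z i).2 = 0 ∧ 0 ≤ l.G i ∧
      l.H i * l.G i = 0 ∧ ((q.relaxedF z i).2 < 0 → 0 ≤ l.H i) := by
  obtain ⟨-, -, -, hP1, hP2⟩ := hl
  by_cases hi : i ∈ q.I1 z ∪ q.I00 z
  · obtain ⟨h1, h2⟩ := normalCone_setP1 (hP1 i hi)
    simp only at h2
    refine ⟨by rw [h1, mul_zero], by rw [h2, zero_mul], h2.ge, by rw [h2, mul_zero], fun h => ?_⟩
    rcases hi with hi | hi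
    · exact absurd ⟨h1.le, h.le⟩ hi.2
    · rw [show q.relaxedF z i = (0, 0) from hi] at h
      exact absurd h (lt_irrefl _)
  · obtain ⟨-, -, h3, h4, h5, h6⟩ := normalCone_setP2 (hP2 i hi)
    refine ⟨h5, h6, h4, ?_, fun _ => h3⟩
    by_contra hne
    obtain ⟨hH, hG⟩ := mul_ne_zero_iff.1 hne
    exact hi (Or.inr (Prod.ext ((mul_eq_zero.1 h5).resolve_left hH)
      ((mul_eq_zero.1 h6).resolve_left hG)))

end AuxData

lemma mul_le_of_le {θ δ ζ : ℝ} (hθ0 : 0 ≤ θ) (hθ1 : θ ≤ 1) (hδ : δ ≤ ζ) (hζ : 0 ≤ ζ) :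
    θ * δ ≤ ζ :=
  (mul_le_mul_of_nonneg_left hδ hθ0).trans (mul_le_of_le_one_left hζ hθ1)

/-- The relaxation only rescales constraint values by factors `1 - τ ≥ 1 - ζ > 0`. -/
lemma tendsto_zero_of_one_sub_mul {ι : Type*} {F : Filter ι} {ζ : ℝ} (hζ : ζ < 1)
    {τ u w : ι → ℝ} (hτ : ∀ k, τ k ≤ ζ) (h : ∀ k, |(1 - τ k) * u k| ≤ w k)
    (hw : Tendsto w F (𝓝 0)) : Tendsto u F (𝓝 0) := by
  have hζ' : 0 < 1 - ζ := by linarith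
  refine squeeze_zero_norm (a := fun k => w k / (1 - ζ)) (fun k => ?_)
    (by simpa using hw.div_const (1 - ζ))
  rw [le_div_iff₀ hζ', Real.norm_eq_abs, mul_comm]
  refine le_trans ?_ (h k)
  rw [abs_mul]
  exact mul_le_mul_of_nonneg_right ((by linarith [hτ k] : 1 - ζ ≤ 1 - τ k).trans (le_abs_self _))
    (abs_nonneg _)

lemma exists_tendsto_of_abs_le {ι : Type*} (F : Ultrafilter ι) {u : ι → ℝ} {C : ℝ}
    (h : ∀ k, |u k| ≤ C) : ∃ l, Tendsto u F (𝓝 l) := by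
  obtain ⟨l, -, hl⟩ := isCompact_Icc.ultrafilter_le_nhds (F.map u)
    (s := Set.Icc (-C) C) (tendsto_principal.2 (Eventually.of_forall fun k => abs_le.1 (h k)))
  exact ⟨l, hl⟩

section Limit

variable {n : ℕ} {E I V : Type*} [Fintype E] [Fintype I] [Fintype V]

/-- If the steps of M-stationary points of the auxiliary problems tend to zero and the relaxation
variables stay below `ζ < 1`, bounded multipliers converge to M-stationary multipliers of the
program. -/
lemma MPVC.isMStationary_of_tendsto (P : MPVC n E I V) {ι : Type*} (F : Ultrafilter ι)
    {x : ι → Vec n} {B : ι → Matrix (Fin n) (Fin n) ℝ} {z : ι → Vec n × ℝ} {ρ : ι → ℝ}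
    {l : ι → Multiplier E I V} {ζ CB C : ℝ} (hζ0 : 0 ≤ ζ) (hζ : ζ < 1) {xbar : Vec n}
    (hx : Tendsto x F (𝓝 xbar)) (hs : Tendsto (fun k => (z k).1) F (𝓝 0))
    (hδ : ∀ k, (z k).2 ≤ ζ) (hB : ∀ k, ‖Matrix.toEuclideanCLM (𝕜 := ℝ) (B k)‖ ≤ CB)
    (hfeas : ∀ k, (P.auxData (B k) (x k)).IsFeasible
      ((P.auxData (B k) (x k)).I1 (z k) ∪ (P.auxData (B k) (x k)).I00 (z k)) (z k))
    (hKKT : ∀ k, (P.auxData (B k) (x k)).IsKKT (ρ k)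
      ((P.auxData (B k) (x k)).I1 (z k) ∪ (P.auxData (B k) (x k)).I00 (z k)) (z k) (l k))
    (hlh : ∀ k i, |(l k).h i| ≤ C) (hlg : ∀ k i, |(l k).g i| ≤ C)
    (hlH : ∀ k i, |(l k).H i| ≤ C) (hlG : ∀ k i, |(l k).G i| ≤ C) :
    P.IsMStationary xbar := by
  set q : ι → AuxData n E I V := fun k => P.auxData (B k) (x k) with hq
  have hval : ∀ {φ : Vec n → ℝ}, ContDiff ℝ 1 φ → Tendsto (fun k => φ (x k)) F (𝓝 (φ xbar)) :=
    fun hφ => (hφ.continuous.tendsto _).comp hx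
  have hgrad : ∀ {φ : Vec n → ℝ}, ContDiff ℝ 1 φ →
      Tendsto (fun k => gradient φ (x k)) F (𝓝 (gradient φ xbar)) :=
    fun hφ => ((continuous_gradient hφ).tendsto _).comp hx
  have hlin : ∀ {φ : Vec n → ℝ}, ContDiff ℝ 1 φ →
      Tendsto (fun k => inner ℝ (gradient φ (x k)) (z k).1) F (𝓝 0) := fun hφ => by
    simpa using Filter.Tendsto.inner (𝕜 := ℝ) (hgrad hφ) hs
  have hlinabs : ∀ {φ : Vec n → ℝ}, ContDiff ℝ 1 φ →
      Tendsto (fun k => |inner ℝ (gradient φ (x k)) (z k).1|) F (𝓝 0) := fun hφ => by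
    simpa using (hlin hφ).abs
  have hζ' : 0 < 1 - ζ := by linarith
  have hτg : ∀ i k, (q k).thetag i * (z k).2 ≤ ζ := fun i k =>
    mul_le_of_le ((q k).thetag_mem i).1 ((q k).thetag_mem i).2 (hδ k) hζ0
  have hτH : ∀ i k, (z k).2 * ((q k).thetaHG i).1 ≤ ζ := fun i k => by
    rw [mul_comm]
    exact mul_le_of_le ((q k).thetaHG_fst_mem i).1 ((q k).thetaHG_fst_mem i).2 (hδ k) hζ0
  have hτG : ∀ i k, (z k).2 * ((q k).thetaHG i).2 ≤ ζ := fun i k => by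
    rw [mul_comm]
    exact mul_le_of_le ((q k).thetaHG_snd_mem i).1 ((q k).thetaHG_snd_mem i).2 (hδ k) hζ0
  -- feasibility of the limit
  have feas_h : ∀ i, P.h i xbar = 0 := fun i => by
    refine tendsto_nhds_unique (hval (P.contDiff_h i)) (tendsto_zero_of_one_sub_mul hζ hδ
      (fun k => ?_) (hlinabs (P.contDiff_h i)))
    have h : (1 - (z k).2) * P.h i (x k) + inner ℝ (gradient (P.h i) (x k)) (z k).1 = 0 :=
      (hfeas k).eq_h i
    rw [eq_neg_of_add_eq_zero_left h, abs_neg]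
  have feas_g : ∀ i, P.g i xbar ≤ 0 := fun i => by
    refine le_of_tendsto_of_tendsto' ((hval (P.contDiff_g i)).const_mul (1 - ζ))
      (hlinabs (P.contDiff_g i)) (fun k => ?_) |> fun h => nonpos_of_mul_nonpos_right h hζ'
    rcases le_total (P.g i (x k)) 0 with h | h
    · exact (mul_nonpos_of_nonneg_of_nonpos hζ'.le h).trans (abs_nonneg _)
    · have h1 : (1 - (q k).thetag i * (z k).2) * P.g i (x k)
          + inner ℝ (gradient (P.g i) (x k)) (z k).1 ≤ 0 := (hfeas k).le_g i
      have h2 := mul_le_mul_of_nonneg_right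
        (by linarith [hτg i k] : 1 - ζ ≤ 1 - (q k).thetag i * (z k).2) h
      linarith [neg_abs_le (inner ℝ (gradient (P.g i) (x k)) (z k).1)]
  have feas_F : ∀ i, (-P.H i xbar, P.G i xbar) ∈ setP := fun i => by
    refine mem_setP_of_dist1_eq_zero (le_antisymm ?_ (dist1_nonneg _ _))
    have ht : Tendsto (fun k => dist1 (-P.H i (x k), P.G i (x k)) setP) F
        (𝓝 (dist1 (-P.H i xbar, P.G i xbar) setP)) :=
      (continuous_dist1_setP.tendsto _).comp
        ((hval (P.contDiff_H i)).neg.prodMk_nhds (hval (P.contDiff_G i)))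
    have hr : Tendsto (fun k => |inner ℝ (gradient (P.H i) (x k)) (z k).1|
        + |inner ℝ (gradient (P.G i) (x k)) (z k).1|) F (𝓝 0) := by
      simpa using (hlinabs (P.contDiff_H i)).add (hlinabs (P.contDiff_G i))
    refine le_of_tendsto_of_tendsto' (ht.const_mul (1 - ζ)) hr (fun k => ?_) |>
      fun h => nonpos_of_mul_nonpos_right h hζ'
    classical
    have hf : (q k).IsFeasible ((q k).I1 (z k) ∪ (q k).I00 (z k)) (z k) := hfeas k
    have h1 := hf.dist1_le i inferInstance
    have h2 := dist1_anti ((q k).F i) (piece_nonempty (i ∈ (q k).I1 (z k) ∪ (q k).I00 (z k)))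
      (piece_subset _)
    have h3 := dist1_add_le ((q k).F i + (q k).dF i (z k).1) (-(q k).dF i (z k).1)
      (piece_nonempty (i ∈ (q k).I1 (z k) ∪ (q k).I00 (z k)))
    rw [add_neg_cancel_right] at h3
    have h4 := mul_le_mul_of_nonneg_left (hδ k) (dist1_nonneg ((q k).F i) setP)
    have h5 : |(-(q k).dF i (z k).1).1| + |(-(q k).dF i (z k).1).2|
        = |inner ℝ (gradient (P.H i) (x k)) (z k).1|
          + |inner ℝ (gradient (P.G i) (x k)) (z k).1| := by
      simp [hq, AuxData.dF, MPVC.auxData]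
    rw [h5] at h3
    change (1 - ζ) * dist1 ((q k).F i) setP ≤ _
    linarith
  -- limits of the multipliers
  choose lh hlh' using fun i => exists_tendsto_of_abs_le F fun k => hlh k i
  choose lg hlg' using fun i => exists_tendsto_of_abs_le F fun k => hlg k i
  choose lH hlH' using fun i => exists_tendsto_of_abs_le F fun k => hlH k i
  choose lG hlG' using fun i => exists_tendsto_of_abs_le F fun k => hlG k i
  have hcomp := fun k i => (hKKT k).complementarity i
  have nonneg_G : ∀ i, 0 ≤ lG i := fun i => ge_of_tendsto' (hlG' i) fun k => (hcomp k i).2.2.1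
  refine ⟨⟨feas_h, feas_g, fun i => ?_⟩, ⟨lh, lg, lH, lG⟩, ⟨?_, fun i => ?_, fun i => ?_,
    fun i => ?_, fun i => ?_, fun i hi => ?_, fun i _ => nonneg_G i⟩, fun i _ => ?_⟩
  · obtain ⟨h1, h2⟩ := feas_F i
    simp only at h1 h2
    exact ⟨by linarith, by linarith⟩
  · have hBs : Tendsto (fun k => (q k).opB (z k).1) F (𝓝 0) := by
      refine squeeze_zero_norm (a := fun k => CB * ‖(z k).1‖) (fun k => ?_)
        (by simpa using hs.norm.const_mul CB)
      exact ((q k).opB.le_opNorm _).trans (mul_le_mul_of_nonneg_right (hB k) (norm_nonneg _))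
    have hlim := (((hBs.add (hgrad P.contDiff_f)).add
      (tendsto_finsetSum Finset.univ fun i _ => (hlh' i).smul (hgrad (P.contDiff_h i)))).add
      (tendsto_finsetSum Finset.univ fun i _ => (hlg' i).smul (hgrad (P.contDiff_g i)))).add
      (tendsto_finsetSum Finset.univ fun i _ =>
        ((hlH' i).smul (hgrad (P.contDiff_H i))).neg.add
          ((hlG' i).smul (hgrad (P.contDiff_G i))))
    rw [zero_add] at hlim
    refine tendsto_nhds_unique hlim (tendsto_const_nhds.congr fun k => ?_)
    exact ((hKKT k).1).symm
  · refine tendsto_nhds_unique ((hlg' i).mul (hval (P.contDiff_g i)))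
      (tendsto_zero_of_one_sub_mul hζ (hτg i)
        (w := fun k => |(l k).g i * inner ℝ (gradient (P.g i) (x k)) (z k).1|) (fun k => ?_)
        (by simpa using ((hlg' i).mul (hlin (P.contDiff_g i))).abs))
    have h : (l k).g i * ((1 - (q k).thetag i * (z k).2) * P.g i (x k)
      + inner ℝ (gradient (P.g i) (x k)) (z k).1) = 0 := ((hKKT k).2.2.1 i).1
    rw [← abs_neg]
    exact (congrArg _ (by linarith)).le
  · refine tendsto_nhds_unique ((hlH' i).mul (hval (P.contDiff_H i)))
      (tendsto_zero_of_one_sub_mul hζ (hτH i)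
        (w := fun k => |(l k).H i * inner ℝ (gradient (P.H i) (x k)) (z k).1|) (fun k => ?_)
        (by simpa using ((hlH' i).mul (hlin (P.contDiff_H i))).abs))
    have h : (l k).H i * (-((1 - (z k).2 * ((q k).thetaHG i).1) * P.H i (x k))
      - inner ℝ (gradient (P.H i) (x k)) (z k).1) = 0 := by
      have := (hcomp k i).1
      rwa [AuxData.relaxedF_fst'] at this
    rw [← abs_neg]
    exact (congrArg _ (by linarith)).le
  · refine tendsto_nhds_unique ((hlG' i).mul (hval (P.contDiff_G i)))
      (tendsto_zero_of_one_sub_mul hζ (hτG i)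
        (w := fun k => |(l k).G i * inner ℝ (gradient (P.G i) (x k)) (z k).1|) (fun k => ?_)
        (by simpa using ((hlG' i).mul (hlin (P.contDiff_G i))).abs))
    have h : (l k).G i * ((1 - (z k).2 * ((q k).thetaHG i).2) * P.G i (x k)
      + inner ℝ (gradient (P.G i) (x k)) (z k).1) = 0 := by
      have := (hcomp k i).2.1
      rwa [AuxData.relaxedF_snd'] at this
    rw [← abs_neg]
    exact (congrArg _ (by linarith)).le
  · exact ge_of_tendsto' (hlg' i) fun k => ((hKKT k).2.2.1 i).2
  · -- near the limit `G < 0`, so the constraint belongs to the piece `setP2`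
    have hG : P.G i xbar < 0 := hi.2
    have h1 : Tendsto (fun k => (1 - ζ) * P.G i (x k) + inner ℝ (gradient (P.G i) (x k)) (z k).1) F
        (𝓝 ((1 - ζ) * P.G i xbar + 0)) :=
      ((hval (P.contDiff_G i)).const_mul _).add (hlin (P.contDiff_G i))
    have h2 : (1 - ζ) * P.G i xbar + 0 < 0 := by
      rw [add_zero]; exact mul_neg_of_pos_of_neg hζ' hG
    refine ge_of_tendsto (hlH' i) ?_
    filter_upwards [h1.eventually (gt_mem_nhds h2),
      (hval (P.contDiff_G i)).eventually (gt_mem_nhds hG)] with k h3 h4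
    refine (hcomp k i).2.2.2.2 ?_
    have e : (P.auxData (B k) (x k)).G i = P.G i (x k) := rfl
    have e' : (P.auxData (B k) (x k)).dG i = gradient (P.G i) (x k) := rfl
    rw [AuxData.relaxedF_snd', e, e']
    have h5 := mul_le_mul_of_nonpos_right
      (by linarith [hτG i k] : 1 - ζ ≤ 1 - (z k).2 * ((q k).thetaHG i).2) h4.le
    linarith
  · refine tendsto_nhds_unique ((hlH' i).mul (hlG' i)) (tendsto_const_nhds.congr fun k => ?_)
    exact (hcomp k i).2.2.2.1.symm

end Limit

end VanishingConstraints

theorem mainTheorem1 {n : ℕ} {E I V : Type*} [Fintype E] [Fintype I] [Fintype V]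
    (P : VanishingConstraints.MPVC n E I V) (p : VanishingConstraints.Params)
    (a : VanishingConstraints.Iterates n E I V)
    (hgen : a.IsGenerated P p) (hbdd : a.IsBounded)
    (xbar : VanishingConstraints.Vec n) (hx : MapClusterPt xbar Filter.atTop a.x) :
    P.IsMStationary xbar := by
  obtain ⟨F, hF, hxF⟩ := mapClusterPt_iff_ultrafilter.1 hx
  obtain ⟨C, hC⟩ := hbdd.lamM_bdd
  obtain ⟨CB, hCB⟩ := hbdd.norm_bdd
  have hs : Tendsto (fun k => (a.pass k).s (a.pass k).N) atTop (𝓝 0) :=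
    squeeze_zero_norm (fun k => (a.pass k).norm_s_le_len (hgen.isPass k).s_zero _)
      (hgen.tendsto_len hbdd)
  exact P.isMStationary_of_tendsto F (B := a.B) (z := fun k => (a.pass k).pt (a.pass k).N)
    (ρ := fun k => a.ρ (k + 1)) (l := a.lamM) p.ζ_pos.le p.ζ_lt hxF (hs.mono_left hF)
    (fun k => (hgen.succeeds k).2.le) hCB (fun k => ((hgen.succeeds k).1.2 3).1) hgen.multiplier
    (fun k => (hC k).1) (fun k => (hC k).2.1) (fun k i => ((hC k).2.2 i).1)
    (fun k i => ((hC k).2.2 i).2)
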